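/- Let $K$ be a perfect field with algebraic closure $\overline K$ and $G_K=\operatorname{Gal}(\overline K/K)$. Let $C/K$ be a smooth, projective, geometrically integral curve of genus one, and let $E=\operatorname{Jac}(C)=\operatorname{Pic}^0_{C/K}$, so that $E(\overline K)=\operatorname{Pic}^0(C_{\overline K})$ as a $G_K$-module. Let $[C]\in H^1(G_K,E)=H^1(G_K,E(\overline K))$ be the Weil–Châtelet class of $C$, that is, the class of the continuous cocycle $\sigma\mapsto[\sigma P_0-P_0]$ for any $P_0\in C(\overline K)$. Let $d\ge 2$ be an integer, and suppose that $C$ has a point of degree $d$ over $K$, that is, a closed point whose residue field has degree $d$ over $K$. Then $d\,[C]=0$ in $H^1(G_K,E)$, and $[C]$ lies in the image of the natural map $H^1(G_K,E[d])\to H^1(G_K,E)$ of the Kummer sequence $$0\to E(K)/dE(K)\to H^1(G_K,E[d])\to H^1(G_K,E)[d]\to 0,$$ where $E[d]$ is the $d$-torsion subgroup of $E(\overline K)$. Cohomology is continuous cohomology with discrete coefficients. -/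

import Mathlib

open CategoryTheory CategoryTheory.Limits AlgebraicGeometry

universe u

namespace GenusOne

noncomputable section

/-! ### Continuous cohomology in degree one -/

section Cohomology

variable (G : Type*) [Group G] [TopologicalSpace G]
variable (M : Type*) [AddCommGroup M] [DistribMulAction G M]

/-- Continuous `1`-cocycles of `G` with values in the discrete `G`-module `M`. -/
def Z1 : AddSubgroup (G → M) where
  carrier := {c | IsLocallyConstant c ∧ ∀ s t : G, c (s * t) = c s + s • c t}
  zero_mem' := ⟨IsLocallyConstant.const 0, fun s t => by simp⟩
  add_mem' := by
    rintro a b ⟨ha, ha'⟩ ⟨hb, hb'⟩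
    refine ⟨ha.add hb, fun s t => ?_⟩
    simp only [Pi.add_apply, ha', hb', smul_add]
    abel
  neg_mem' := by
    rintro a ⟨ha, ha'⟩
    refine ⟨ha.neg, fun s t => ?_⟩
    simp only [Pi.neg_apply, ha', smul_neg]
    abel

/-- The `1`-coboundaries `s ↦ s • m - m`. -/
def B1 : AddSubgroup (G → M) where
  carrier := {c | ∃ m : M, ∀ s : G, c s = s • m - m}
  zero_mem' := ⟨0, fun s => by simp⟩
  add_mem' := by
    rintro a b ⟨m, hm⟩ ⟨n, hn⟩
    refine ⟨m + n, fun s => ?_⟩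
    simp only [Pi.add_apply, hm, hn, smul_add]
    abel
  neg_mem' := by
    rintro a ⟨m, hm⟩
    refine ⟨-m, fun s => ?_⟩
    simp only [Pi.neg_apply, hm, smul_neg]
    abel

/-- `H¹(G, M)`: continuous `1`-cocycles modulo `1`-coboundaries. -/
abbrev H1 : Type _ := Z1 G M ⧸ (B1 G M).addSubgroupOf (Z1 G M)

variable {G M} {N : Type*} [AddCommGroup N] [DistribMulAction G N]

/-- The map on cocycles induced by a `G`-equivariant homomorphism. -/
def Z1.map (φ : M →+[G] N) : Z1 G M →+ Z1 G N where
  toFun c := ⟨fun s => φ (c.1 s), c.2.1.comp φ, fun s t => by simp [c.2.2 s t]⟩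
  map_zero' := by ext s; simp
  map_add' a b := by ext s; simp

/-- The map `H¹(G, M) → H¹(G, N)` induced by a `G`-equivariant homomorphism. -/
def H1.map (φ : M →+[G] N) : H1 G M →+ H1 G N :=
  QuotientAddGroup.map _ _ (Z1.map φ) (by
    rintro ⟨c, hc⟩ ⟨m, hm⟩
    exact ⟨φ m, fun s => by
      have := hm s
      simp only [AddSubgroup.coe_subtype] at this
      simp [Z1.map, this]⟩)

end Cohomology

section Torsion

variable (G : Type*) [Group G] (M : Type*) [AddCommGroup M] [DistribMulAction G M] (d : ℕ)

instance : DistribMulAction G (AddSubgroup.torsionBy M (d : ℤ)) where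
  smul s x := ⟨s • x.1, AddSubgroup.torsionBy.nsmul_iff.2 (by
    rw [smul_comm, AddSubgroup.torsionBy.nsmul_iff.1 x.2, smul_zero])⟩
  one_smul x := Subtype.ext (one_smul G x.1)
  mul_smul s t x := Subtype.ext (mul_smul s t x.1)
  smul_zero s := Subtype.ext (smul_zero s)
  smul_add s x y := Subtype.ext (smul_add s x.1 y.1)

/-- The inclusion `M[d] → M` of the `d`-torsion, as a map of `G`-modules. -/
def torsionIncl : AddSubgroup.torsionBy M (d : ℤ) →+[G] M where
  toFun x := x.1
  map_smul' _ _ := rfl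
  map_zero' := rfl
  map_add' _ _ := rfl

end Torsion

/-! ### Orders of vanishing and isomorphisms -/

section Ord

lemma ringOrd_equiv {R S : Type*} [CommRing R] [CommRing S] (e : R ≃+* S) (a : R) :
    Ring.ord S (e a) = Ring.ord R a := by
  have h : Ideal.span {e a} = (Ideal.span {a}).map (e : R →+* S) := by
    simp [Ideal.map_span]
  let E := Ideal.quotientEquiv (Ideal.span {a}) (Ideal.span {e a}) e h
  let _ := RingHomInvPair.of_ringEquiv e
  let _ := RingHomInvPair.symm (e : R →+* S) (e.symm : S →+* R)
  let E' : (R ⧸ Ideal.span {a}) ≃ₛₗ[(e : R →+* S)] (S ⧸ Ideal.span {e a}) :=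
    { E with
      map_smul' := fun r x => by
        obtain ⟨x, rfl⟩ := Ideal.Quotient.mk_surjective x
        change Ideal.Quotient.mk _ (e (r * x)) = Ideal.Quotient.mk _ (e r * e x)
        rw [map_mul] }
  rw [Ring.ord, Ring.ord]
  apply WithBot.coe_injective
  rw [Module.coe_length, Module.coe_length]
  exact (Order.krullDim_eq_of_orderIso (Submodule.orderIsoMapComap E')).symm

lemma ordFrac_equiv {R S K L : Type*} [CommRing R] [CommRing S] [IsNoetherianRing R]
    [IsNoetherianRing S] [Ring.KrullDimLE 1 R] [Ring.KrullDimLE 1 S] [IsDomain R] [IsDomain S]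
    [Field K] [Field L] [Algebra R K] [Algebra S L] [IsFractionRing R K] [IsFractionRing S L]
    (e : R ≃+* S) (E : K →+* L) (h : ∀ a, E (algebraMap R K a) = algebraMap S L (e a)) (x : K) :
    Ring.ordFrac S (E x) = Ring.ordFrac R x := by
  have key (a : R) (ha : a ≠ 0) :
      Ring.ordFrac S (E (algebraMap R K a)) = Ring.ordFrac R (algebraMap R K a) := by
    have ha' : e a ≠ 0 := by simpa using ha
    rw [h, Ring.ordFrac_eq_ord S ha', Ring.ordFrac_eq_ord R ha,
      Ring.ordMonoidWithZeroHom_eq_ord (mem_nonZeroDivisors_iff_ne_zero.2 ha'),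
      Ring.ordMonoidWithZeroHom_eq_ord (mem_nonZeroDivisors_iff_ne_zero.2 ha), ringOrd_equiv]
  obtain ⟨a, b, hb, rfl⟩ := IsFractionRing.div_surjective (A := R) x
  by_cases ha : a = 0
  · simp [ha]
  · rw [map_div₀, map_div₀, map_div₀, key a ha, key b (nonZeroDivisors.ne_zero hb)]

lemma coheight_of_isIso {X Y : Scheme.{u}} (φ : X ⟶ Y) [IsIso φ] (x : X) :
    Order.coheight (φ x) = Order.coheight x := by
  let F : X ≃o Y :=
    { toEquiv := (Scheme.homeoOfIso (asIso φ)).toEquiv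
      map_rel_iff' := fun {a b} => by
        change (Scheme.homeoOfIso (asIso φ)) b ⤳ (Scheme.homeoOfIso (asIso φ)) a ↔ b ⤳ a
        exact (Scheme.homeoOfIso (asIso φ)).isInducing.specializes_iff }
  exact Order.coheight_orderIso F x

lemma exists_ord_comp_eq {X Y : Scheme.{u}} [IsIntegral X] [IsLocallyNoetherian X] [IsIntegral Y]
    [IsLocallyNoetherian Y] (φ : X ⟶ Y) [IsIso φ] (g : Y.functionField) (hg : g ≠ 0) :
    ∃ h : X.functionField, h ≠ 0 ∧ ∀ x : X, Scheme.ord h x = Scheme.ord g (φ x) := by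
  have hξ : φ (genericPoint X) = genericPoint Y := genericPoint_eq_of_isOpenImmersion φ
  have hs : φ (genericPoint X) ⤳ genericPoint Y := by rw [hξ]
  let E : Y.functionField ⟶ X.functionField :=
    Y.presheaf.stalkSpecializes hs ≫ φ.stalkMap (genericPoint X)
  have hE (x : X) : Y.presheaf.stalkSpecializes ((genericPoint_spec Y).specializes trivial) ≫ E =
      φ.stalkMap x ≫ X.presheaf.stalkSpecializes ((genericPoint_spec X).specializes trivial) := by
    simp only [E]
    rw [TopCat.Presheaf.stalkSpecializes_comp_assoc]
    exact Scheme.Hom.stalkSpecializes_stalkMap φ _ _ ((genericPoint_spec X).specializes trivial)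
  have hEg : E.hom g ≠ 0 := (map_ne_zero E.hom).2 hg
  refine ⟨E.hom g, hEg, fun x => ?_⟩
  by_cases hx : Order.coheight x = 1
  · have hy : Order.coheight (φ x) = 1 := (coheight_of_isIso φ x).trans hx
    rw [Scheme.ord_eq_ordHom_of_coheight_eq_one hx, Scheme.ord_eq_ordHom_of_coheight_eq_one hy]
    congr 2
    have h1 : Ring.KrullDimLE 1 (X.presheaf.stalk x) := krullDimLE_of_coheight_le hx.le
    have h2 : Ring.KrullDimLE 1 (Y.presheaf.stalk (φ x)) := krullDimLE_of_coheight_le hy.le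
    exact ordFrac_equiv (asIso (φ.stalkMap x)).commRingCatIsoToRingEquiv E.hom
      (fun a => congr($(hE x).hom a)) g
  · rw [Scheme.ord_eq_zero_of_coheight_neq_one hx,
      Scheme.ord_eq_zero_of_coheight_neq_one (by rwa [coheight_of_isIso])]

end Ord

/-! ### Divisors on an integral scheme -/

section Divisors

variable (X : Scheme.{u})

/-- Divisors: finite integral combinations of closed points. On a regular integral curve these are
the Weil divisors. -/
abbrev Divisor : Type u := closedPoints X →₀ ℤ

/-- The degree `∑ nₓ` of a divisor `∑ nₓ x` on a curve over an algebraically closed field (all of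
whose closed points have degree one). -/
def Divisor.degree : Divisor X →+ ℤ := Finsupp.liftAddHom fun _ => AddMonoidHom.id ℤ

variable [IsIntegral X] [IsLocallyNoetherian X]

/-- Principal divisors `div g = ∑ₓ ordₓ(g) x`, for `g` a nonzero rational function. -/
def principalDivisors : AddSubgroup (Divisor X) where
  carrier := {D | ∃ g : X.functionField, g ≠ 0 ∧ ∀ x : closedPoints X, D x = Scheme.ord g x.1}
  zero_mem' := ⟨1, one_ne_zero, fun x => by
    have h := Scheme.ord_mul (x := x.1) (one_ne_zero (α := X.functionField)) one_ne_zero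
    rw [mul_one] at h
    rw [Finsupp.coe_zero, Pi.zero_apply]
    omega⟩
  add_mem' := by
    rintro D D' ⟨g, hg, h⟩ ⟨g', hg', h'⟩
    exact ⟨g * g', mul_ne_zero hg hg', fun x => by
      rw [Scheme.ord_mul hg hg', Finsupp.add_apply, h, h']⟩
  neg_mem' := by
    rintro D ⟨g, hg, h⟩
    refine ⟨g⁻¹, inv_ne_zero hg, fun x => ?_⟩
    have h1 := Scheme.ord_mul (x := x.1) hg (inv_ne_zero hg)
    have h2 := Scheme.ord_mul (x := x.1) (one_ne_zero (α := X.functionField)) one_ne_zero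
    rw [mul_inv_cancel₀ hg] at h1
    rw [mul_one] at h2
    rw [Finsupp.neg_apply, h]
    omega

/-- `Pic⁰` of a curve over an algebraically closed field: divisors of degree zero modulo principal
divisors. -/
def Pic0 : Type u :=
  (Divisor.degree X).ker ⧸ (principalDivisors X).addSubgroupOf (Divisor.degree X).ker

instance : AddCommGroup (Pic0 X) :=
  inferInstanceAs (AddCommGroup (_ ⧸ (principalDivisors X).addSubgroupOf (Divisor.degree X).ker))

variable {X}

/-- The class of a divisor of degree zero. -/
def Pic0.mk : (Divisor.degree X).ker →+ Pic0 X :=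
  QuotientAddGroup.mk' ((principalDivisors X).addSubgroupOf (Divisor.degree X).ker)

variable {k : Type u} [Field k] (π : X ⟶ Spec (.of k))

/-- The inclusion of the base field, as constants, in the function field. -/
def constants : k →+* X.functionField :=
  ((Scheme.ΓSpecIso (.of k)).inv ≫ π.appTop ≫ X.presheaf.germ ⊤ (genericPoint X) trivial).hom

/-- `ℓ(D)`, the dimension over `k` of the Riemann-Roch space
`L(D) = {h | h = 0 or div h + D ≥ 0}`. (On a regular curve `L(D)` is a subspace of the function
field, so that it equals its span.) -/
def ell (D : Divisor X) : ℕ :=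
  letI : Module k X.functionField := Module.compHom _ (constants π)
  Module.finrank k (Submodule.span k
    {h : X.functionField | h ≠ 0 → ∀ x : closedPoints X, 0 ≤ Scheme.ord h x.1 + D x})

/-- The genus of a curve over an algebraically closed field is the maximum of
`deg D - ℓ(D) + 1` over all divisors `D`. -/
def HasGenus (g : ℕ) : Prop :=
  IsGreatest (Set.range fun D : Divisor X => Divisor.degree X D - (ell π D : ℤ) + 1) (g : ℤ)

end Divisors

/-! ### The geometric fibre, its Galois action, and the Weil-Châtelet class -/

section Galois

variable {K : Type u} [Field K] {C : Scheme.{u}} (f : C ⟶ Spec (.of K))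

/-- `Spec K̄ ⟶ Spec K`. -/
def geomPt (K : Type u) [Field K] : Spec (.of (AlgebraicClosure K)) ⟶ Spec (.of K) :=
  Spec.map (CommRingCat.ofHom (algebraMap K (AlgebraicClosure K)))

/-- The base change `C_K̄ = C ×_K K̄`. -/
abbrev geom : Scheme.{u} := pullback f (geomPt K)

/-- The structure morphism `C_K̄ ⟶ Spec K̄`. -/
abbrev geomStr : geom f ⟶ Spec (.of (AlgebraicClosure K)) := pullback.snd f (geomPt K)

/-- `Spec σ`, for an element `σ` of the absolute Galois group. -/
def specGal (s : Gal(AlgebraicClosure K/K)) :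
    Spec (.of (AlgebraicClosure K)) ⟶ Spec (.of (AlgebraicClosure K)) :=
  Spec.map (CommRingCat.ofHom (s : AlgebraicClosure K →+* AlgebraicClosure K))

lemma specGal_geomPt (s : Gal(AlgebraicClosure K/K)) : specGal s ≫ geomPt K = geomPt K := by
  rw [specGal, geomPt, ← Spec.map_comp, ← CommRingCat.ofHom_comp]
  congr 2
  ext x
  simp

lemma specGal_one : specGal (1 : Gal(AlgebraicClosure K/K)) = 𝟙 _ :=
  Spec.map_id _

lemma specGal_mul (s t : Gal(AlgebraicClosure K/K)) :
    specGal (s * t) = specGal s ≫ specGal t := by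
  rw [specGal, specGal, specGal, ← Spec.map_comp, ← CommRingCat.ofHom_comp]
  rfl

/-- The automorphism `id × Spec σ⁻¹` of `C_K̄`; on closed points, i.e. on `C(K̄)`, it is the usual
action `P ↦ σ P` on coordinates. -/
def galAut (s : Gal(AlgebraicClosure K/K)) : geom f ⟶ geom f :=
  pullback.lift (pullback.fst f (geomPt K)) (geomStr f ≫ specGal s⁻¹) (by
    rw [Category.assoc, specGal_geomPt, pullback.condition])

@[simp]
lemma galAut_fst (s : Gal(AlgebraicClosure K/K)) :
    galAut f s ≫ pullback.fst f (geomPt K) = pullback.fst f (geomPt K) :=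
  pullback.lift_fst _ _ _

@[simp]
lemma galAut_snd (s : Gal(AlgebraicClosure K/K)) :
    galAut f s ≫ pullback.snd f (geomPt K) = pullback.snd f (geomPt K) ≫ specGal s⁻¹ :=
  pullback.lift_snd _ _ _

lemma galAut_one : galAut f 1 = 𝟙 _ := by
  apply pullback.hom_ext <;> simp [specGal_one]

lemma galAut_mul (s t : Gal(AlgebraicClosure K/K)) :
    galAut f (s * t) = galAut f t ≫ galAut f s := by
  apply pullback.hom_ext
  · simp
  · rw [galAut_snd, Category.assoc, galAut_snd, ← Category.assoc, galAut_snd, Category.assoc,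
      ← specGal_mul, mul_inv_rev]

instance (s : Gal(AlgebraicClosure K/K)) : IsIso (galAut f s) :=
  ⟨galAut f s⁻¹, by rw [← galAut_mul, inv_mul_cancel, galAut_one],
    by rw [← galAut_mul, mul_inv_cancel, galAut_one]⟩

/-- The Galois action on the closed points of `C_K̄`, i.e. on `C(K̄)`. -/
instance : MulAction Gal(AlgebraicClosure K/K) (closedPoints (geom f)) where
  smul s x := ⟨galAut f s x.1, by
    have h := (Scheme.homeoOfIso (asIso (galAut f s))).isClosedMap _ x.2
    rwa [Set.image_singleton] at h⟩
  one_smul x := Subtype.ext (by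
    change galAut f 1 x.1 = x.1
    rw [galAut_one]; rfl)
  mul_smul s t x := Subtype.ext (by
    change galAut f (s * t) x.1 = galAut f s (galAut f t x.1)
    rw [galAut_mul]; rfl)

lemma smul_closedPoint_val (s : Gal(AlgebraicClosure K/K)) (x : closedPoints (geom f)) :
    (s • x).1 = galAut f s x.1 := rfl

/-- The Galois action on divisors, `∑ nₓ x ↦ ∑ nₓ σ(x)`. -/
instance : DistribMulAction Gal(AlgebraicClosure K/K) (Divisor (geom f)) where
  smul s D := D.mapDomain (s • ·)
  one_smul D := by
    change D.mapDomain (fun x => (1 : Gal(AlgebraicClosure K/K)) • x) = D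
    simp only [one_smul]
    exact Finsupp.mapDomain_id
  mul_smul s t D := by
    change D.mapDomain (fun x => (s * t) • x) = (D.mapDomain (t • ·)).mapDomain (s • ·)
    rw [← Finsupp.mapDomain_comp]
    simp only [mul_smul]
    rfl
  smul_zero s := Finsupp.mapDomain_zero
  smul_add s D D' := Finsupp.mapDomain_add

lemma smul_divisor_def (s : Gal(AlgebraicClosure K/K)) (D : Divisor (geom f)) :
    s • D = D.mapDomain (s • ·) := rfl

lemma smul_divisor_apply (s : Gal(AlgebraicClosure K/K)) (D : Divisor (geom f))
    (x : closedPoints (geom f)) : (s • D) x = D (s⁻¹ • x) := by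
  conv_lhs => rw [← smul_inv_smul s x]
  exact Finsupp.mapDomain_apply (MulAction.injective s) D (s⁻¹ • x)

lemma degree_smul (s : Gal(AlgebraicClosure K/K)) (D : Divisor (geom f)) :
    Divisor.degree _ (s • D) = Divisor.degree _ D := by
  simp only [Divisor.degree, Finsupp.liftAddHom_apply, smul_divisor_def]
  rw [Finsupp.sum_mapDomain_index] <;> simp

instance : DistribMulAction Gal(AlgebraicClosure K/K) (Divisor.degree (geom f)).ker where
  smul s D := ⟨s • D.1, by
    have h : Divisor.degree (geom f) D.1 = 0 := D.2
    rw [AddMonoidHom.mem_ker, degree_smul, h]⟩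
  one_smul D := Subtype.ext (one_smul _ D.1)
  mul_smul s t D := Subtype.ext (mul_smul s t D.1)
  smul_zero s := Subtype.ext (smul_zero s)
  smul_add s D D' := Subtype.ext (smul_add s D.1 D'.1)

lemma stable_principalDivisors [IsIntegral (geom f)] [IsLocallyNoetherian (geom f)]
    (s : Gal(AlgebraicClosure K/K)) {D : Divisor (geom f)} (hD : D ∈ principalDivisors (geom f)) :
    s • D ∈ principalDivisors (geom f) := by
  obtain ⟨g, hg, h⟩ := hD
  obtain ⟨g', hg', h'⟩ := exists_ord_comp_eq (galAut f s⁻¹) g hg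
  exact ⟨g', hg', fun x => by rw [smul_divisor_apply, h, h', smul_closedPoint_val]⟩

/-- The Galois action on `Pic⁰(C_K̄)`. -/
instance [IsIntegral (geom f)] [IsLocallyNoetherian (geom f)] :
    DistribMulAction Gal(AlgebraicClosure K/K) (Pic0 (geom f)) where
  smul s := QuotientAddGroup.map _ _
    (DistribSMul.toAddMonoidHom (Divisor.degree (geom f)).ker s)
    (fun _ hD => stable_principalDivisors f s hD)
  one_smul x := by
    obtain ⟨D, rfl⟩ := QuotientAddGroup.mk_surjective x
    exact congrArg Pic0.mk (one_smul _ D)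
  mul_smul s t x := by
    obtain ⟨D, rfl⟩ := QuotientAddGroup.mk_surjective x
    exact congrArg Pic0.mk (mul_smul s t D)
  smul_zero s := map_zero _
  smul_add s := map_add _

lemma smul_mk [IsIntegral (geom f)] [IsLocallyNoetherian (geom f)]
    (s : Gal(AlgebraicClosure K/K)) (D : (Divisor.degree (geom f)).ker) :
    s • Pic0.mk D = Pic0.mk (s • D) := rfl

instance [GeometricallyIntegral f] : IsIntegral (geom f) :=
  GeometricallyIntegral.geometrically_isIntegral (f := f) _ _ _ (IsPullback.of_hasPullback _ _)

instance [LocallyOfFiniteType f] : IsLocallyNoetherian (geom f) :=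
  LocallyOfFiniteType.isLocallyNoetherian (geomStr f)

/-- A point of `C(K̄)` has an open stabilizer. -/
lemma isOpen_stabilizer [LocallyOfFiniteType f] (P : closedPoints (geom f)) :
    IsOpen (MulAction.stabilizer Gal(AlgebraicClosure K/K) P : Set Gal(AlgebraicClosure K/K)) := by
  obtain ⟨p, hp⟩ := (pointEquivClosedPoint (geomStr f)).surjective P
  -- It is enough that `σ` fixes the composite `q : Spec K̄ ⟶ C`.
  have key (s : Gal(AlgebraicClosure K/K))
      (hs : specGal s ≫ p.1 ≫ pullback.fst f (geomPt K) = p.1 ≫ pullback.fst f (geomPt K)) :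
      s ∈ MulAction.stabilizer Gal(AlgebraicClosure K/K) P := by
    have h2 : specGal s ≫ p.1 ≫ galAut f s = p.1 := by
      apply pullback.hom_ext
      · simpa using hs
      · simp only [Category.assoc, galAut_snd]
        rw [← Category.assoc p.1, p.2, Category.id_comp, ← specGal_mul, mul_inv_cancel, specGal_one]
    apply Subtype.ext
    rw [smul_closedPoint_val, ← hp]
    let o : Spec (.of (AlgebraicClosure K)) := IsLocalRing.closedPoint (AlgebraicClosure K)
    have h3 : (specGal s ≫ p.1 ≫ galAut f s) o = galAut f s (p.1 o) := by
      rw [Scheme.Hom.comp_apply, Scheme.Hom.comp_apply]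
      congr 2
      exact Subsingleton.elim (α := PrimeSpectrum (AlgebraicClosure K)) _ _
    rw [h2] at h3
    exact h3.symm
  set q := p.1 ≫ pullback.fst f (geomPt K) with hq
  have hqf : q ≫ f = geomPt K := by
    rw [hq, Category.assoc, pullback.condition, ← Category.assoc, p.2, Category.id_comp]
  -- `q` factors through an affine open, whose coordinate ring is of finite type over `K`.
  let o : Spec (.of (AlgebraicClosure K)) := IsLocalRing.closedPoint (AlgebraicClosure K)
  obtain ⟨_, ⟨V, hV, rfl⟩, hqV, -⟩ := C.isBasis_affineOpens.exists_subset_of_mem_open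
    (Set.mem_univ (q o)) isOpen_univ
  have hV : IsAffineOpen V := hV
  have hr : Set.range q ⊆ Set.range hV.fromSpec := by
    rw [hV.range_fromSpec]
    rintro _ ⟨x, rfl⟩
    rwa [Subsingleton.elim (α := PrimeSpectrum (AlgebraicClosure K)) x o]
  let ψ := Spec.preimage (IsOpenImmersion.lift hV.fromSpec q hr)
  have hψ : Spec.map ψ ≫ hV.fromSpec = q := by
    rw [Spec.map_preimage, IsOpenImmersion.lift_fac]
  let θ := Spec.preimage (hV.fromSpec ≫ f)
  have hθ : Spec.map θ = hV.fromSpec ≫ f := Spec.map_preimage _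
  have hft : θ.hom.FiniteType := by
    have h : LocallyOfFiniteType (Spec.map θ) := by rw [hθ]; infer_instance
    exact (HasRingHomProperty.Spec_iff (P := @LocallyOfFiniteType)).1 h
  have hθψ : θ ≫ ψ = CommRingCat.ofHom (algebraMap K (AlgebraicClosure K)) := by
    apply Spec.map_injective
    rw [Spec.map_comp, hθ, ← Category.assoc, hψ, hqf, geomPt]
  let _ := θ.hom.toAlgebra
  obtain ⟨S, hS⟩ := hft.out
  refine Subgroup.isOpen_of_mem_nhds _ (g := 1) ?_
  have hnhds : ∀ᶠ s : Gal(AlgebraicClosure K/K) in nhds 1, ∀ a ∈ S, s (ψ.hom a) = ψ.hom a := by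
    refine (Finset.eventually_all S).2 fun a _ => ?_
    exact (stabilizer_isOpen_of_isIntegral (K := K) (ψ.hom a)).mem_nhds (one_mem _)
  filter_upwards [hnhds] with s hs
  refine key s ?_
  have h4 : ψ ≫ CommRingCat.ofHom (s : AlgebraicClosure K →+* AlgebraicClosure K) = ψ := by
    ext x
    have hx : x ∈ Algebra.adjoin K (S : Set Γ(C, V)) := by rw [hS]; trivial
    induction hx using Algebra.adjoin_induction with
    | mem x hx => exact hs x hx
    | algebraMap r =>
      have h5 : ψ.hom (θ.hom r) = algebraMap K (AlgebraicClosure K) r := congr($(hθψ).hom r)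
      change s (ψ.hom (θ.hom r)) = ψ.hom (θ.hom r)
      rw [h5, AlgEquiv.commutes]
    | add x y _ _ hx hy => rw [map_add, map_add, hx, hy]
    | mul x y _ _ hx hy => rw [map_mul, map_mul, hx, hy]
  rw [← hψ, ← Category.assoc, specGal, ← Spec.map_comp, h4]

lemma isLocallyConstant_smul [LocallyOfFiniteType f] (P : closedPoints (geom f)) :
    IsLocallyConstant fun s : Gal(AlgebraicClosure K/K) => s • P := by
  rw [IsLocallyConstant.iff_exists_open]
  intro s
  refine ⟨(fun t => s⁻¹ * t) ⁻¹' (MulAction.stabilizer Gal(AlgebraicClosure K/K) P : Set _),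
    (isOpen_stabilizer f P).preimage (continuous_const_mul s⁻¹), ?_, fun t ht => ?_⟩
  · simp
  · have h : (s⁻¹ * t) • P = P := ht
    rwa [mul_smul, inv_smul_eq_iff] at h

/-- The divisor `P - Q`. -/
def diff {X : Scheme.{u}} (P Q : closedPoints X) : (Divisor.degree X).ker :=
  ⟨Finsupp.single P 1 - Finsupp.single Q 1, by
    rw [AddMonoidHom.mem_ker, map_sub]
    simp [Divisor.degree]⟩

variable [GeometricallyIntegral f] [LocallyOfFiniteType f]

/-- The Galois module `E(K̄) = Pic⁰(C_K̄)` of geometric points of the Jacobian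
`E = Jac C = Pic⁰_{C/K}`. -/
abbrev Jac : Type u := Pic0 (geom f)

/-- The cocycle `σ ↦ [σ P - P]` with values in `Pic⁰(C_K̄)`, for a point `P` of `C(K̄)`. -/
def wcCocycle (P : closedPoints (geom f)) :
    Z1 Gal(AlgebraicClosure K/K) (Jac f) :=
  ⟨fun s => Pic0.mk (diff (s • P) P), isLocallyConstant_smul f P |>.comp fun Q => Pic0.mk (diff Q P),
    fun s t => by
    rw [smul_mk, ← map_add]
    refine congrArg Pic0.mk (Subtype.ext ?_)
    change _ = (diff (s • P) P).1 + s • (diff (t • P) P).1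
    simp only [diff, smul_sub, smul_divisor_def, Finsupp.mapDomain_single, mul_smul]
    abel⟩

/-- The class of `σ ↦ [σ P - P]` does not depend on `P`. -/
lemma mk_wcCocycle_eq (P Q : closedPoints (geom f)) :
    (QuotientAddGroup.mk (wcCocycle f P) : H1 Gal(AlgebraicClosure K/K) (Jac f)) =
      QuotientAddGroup.mk (wcCocycle f Q) := by
  rw [QuotientAddGroup.eq, AddSubgroup.mem_addSubgroupOf]
  refine ⟨Pic0.mk (diff Q P), fun s => ?_⟩
  change -Pic0.mk (diff (s • P) P) + Pic0.mk (diff (s • Q) Q) = _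
  rw [smul_mk, ← map_neg, ← map_add, ← map_sub]
  refine congrArg Pic0.mk (Subtype.ext ?_)
  change -(diff (s • P) P).1 + (diff (s • Q) Q).1 = s • (diff Q P).1 - (diff Q P).1
  simp only [diff, smul_sub, smul_divisor_def, Finsupp.mapDomain_single]
  abel

instance : Nonempty (closedPoints (geom f)) := by
  have : JacobsonSpace (geom f) := LocallyOfFiniteType.jacobsonSpace (geomStr f)
  have h := closure_closedPoints (X := geom f)
  by_contra hn
  rw [Set.not_nonempty_iff_eq_empty.1 (fun hne => hn hne.to_subtype), closure_empty] at h
  exact Set.empty_ne_univ h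

/-- The Weil-Châtelet class `[C] ∈ H¹(G_K, E)`, where `E = Jac C`: the class of the cocycle
`σ ↦ [σ P - P]`, for any `P ∈ C(K̄)` (see `wcClass_eq`). -/
def wcClass : H1 Gal(AlgebraicClosure K/K) (Jac f) :=
  QuotientAddGroup.mk (wcCocycle f (Classical.arbitrary _))

lemma wcClass_eq (P : closedPoints (geom f)) :
    wcClass f = QuotientAddGroup.mk (wcCocycle f P) :=
  mk_wcCocycle_eq f _ P

end Galois

end

end GenusOne

/-!
Write `E = Pic⁰(C_K̄)` for the geometric points of the Jacobian and `c` for the cocycle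
`σ ↦ [σ P - P]`, where `P` is a geometric point of `C`.

A point of degree `d` has exactly `d` geometric points above it, since `K` is perfect. Their sum is
a Galois-invariant divisor `D` of degree `d` (`exists_invariant_divisor`), so that `d c` is the
coboundary of `m = [d P - D]`, and `d [C] = 0`. If moreover `m = d n` for some `n` in `E`, then `c`
minus the coboundary of `n` is a cocycle with values in `E[d]` and in the class of `c`. It is
continuous if `n` is the class of a divisor `Q - P`, because geometric points have open stabilizers
(`exists_map_torsionIncl_eq`).

The remaining point is the divisibility of `E`, which is proved without the theory of isogenies,
from the axioms collected in `FunctionField`: the orders of vanishing of rational functions at the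
closed points, and genus one in the form that `deg D ≤ ℓ(D)`, with equality for some `D`. The axioms
hold because the local rings of a smooth curve are discrete valuation rings
(`isDiscreteValuationRing_stalk`) with residue field `K̄`.

From them one gets that principal divisors have degree zero (`FunctionField.deg_div`), that no
function has a single simple pole (`FunctionField.ge_of_ge_neg_one`), that the points correspond to
the elements of `E` once an origin `O` is chosen (`FunctionField.ptEquiv`), a Weierstrass equation
(`FunctionField.exists_weierstrass`) and the formulas for negatives and chords
(`Weierstrass.yAt_neg`, `Weierstrass.exists_chord`). Apply the chord formula to the universal point:
as long as no positive `m ≤ n` annihilates `E`, the coordinates of `n T` are rational functions of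
`T` (`FunctionField.exists_isRational`). The first one is not constant, and a nonconstant function
takes every value, so up to sign almost every point is a multiple `n T`, and hence every point is
(`FunctionField.surjective_nsmul_of_isRational`).

It remains to see that no positive integer annihilates `E` (`FunctionField.exists_nsmul_eq`). If `N`
is the least one, then all positive `m < N` are surjective on `E`, so `N` is prime. It is not `2`
(`Weierstrass.exists_add_self_ne_zero`), so `E` has no point of order two. This leaves only the
supersingular curves in characteristic two, and those have a point of order three and are not
annihilated by three (`Weierstrass.three_torsion_of_two_torsion_eq_zero`), a contradiction.
-/

namespace GenusOne

/-! ### Function fields of genus one -/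

/-- The numerical data of the function field `F` of a curve of genus one over an algebraically
closed field `k`, with set of points `X`: the order of vanishing of a function at a point, the fact
that all residue fields are `k`, and the two halves of the definition of genus one in terms of the
dimensions of the spaces `L(D)`, written as spans as in `GenusOne.ell`. -/
structure FunctionField (k F X : Type*) [Field k] [Field F] [Algebra k F] where
  ord : F → X → ℤ
  ord_mul' : ∀ {f g : F}, f ≠ 0 → g ≠ 0 → ∀ T, ord (f * g) T = ord f T + ord g T
  ord_add' : ∀ {f g : F}, f ≠ 0 → g ≠ 0 → f + g ≠ 0 → ∀ T,
    min (ord f T) (ord g T) ≤ ord (f + g) T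
  ord_const' : ∀ {c : k}, c ≠ 0 → ∀ T, ord (algebraMap k F c) T = 0
  exists_residue' : ∀ {f : F}, f ≠ 0 → ∀ T, 0 ≤ ord f T →
    ∃ c : k, f - algebraMap k F c ≠ 0 → 1 ≤ ord (f - algebraMap k F c) T
  finite_support' : ∀ {f : F}, f ≠ 0 → {T | ord f T ≠ 0}.Finite
  riemann_inequality' : ∀ D : X →₀ ℤ, Finsupp.liftAddHom (fun _ => AddMonoidHom.id ℤ) D ≤
    (Module.finrank k (Submodule.span k {h : F | h ≠ 0 → ∀ T, 0 ≤ ord h T + D T}) : ℤ)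
  exists_deg_eq' : ∃ D : X →₀ ℤ, Finsupp.liftAddHom (fun _ => AddMonoidHom.id ℤ) D =
    (Module.finrank k (Submodule.span k {h : F | h ≠ 0 → ∀ T, 0 ≤ ord h T + D T}) : ℤ)

namespace FunctionField

variable {k F X : Type*} [Field k] [Field F] [Algebra k F] (P : FunctionField k F X)

/-- `P.Ge n T f`: the function `f` vanishes to order at least `n` at `T`. The zero function
vanishes to every order. -/
def Ge (n : ℤ) (T : X) (f : F) : Prop := f ≠ 0 → n ≤ P.ord f T

variable {P} {n m : ℤ} {T : X} {f g : F}

lemma Ge.zero : P.Ge n T 0 := fun h => absurd rfl h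

lemma Ge.of_le (h : P.Ge n T f) (hm : m ≤ n) : P.Ge m T f := fun h0 => hm.trans (h h0)

lemma Ge.mul (hf : P.Ge n T f) (hg : P.Ge m T g) : P.Ge (n + m) T (f * g) := fun h => by
  have h1 := left_ne_zero_of_mul h
  have h2 := right_ne_zero_of_mul h
  rw [P.ord_mul' h1 h2]
  exact add_le_add (hf h1) (hg h2)

lemma Ge.add (hf : P.Ge n T f) (hg : P.Ge n T g) : P.Ge n T (f + g) := fun h => by
  by_cases h1 : f = 0
  · subst h1; simpa using hg (by simpa using h)
  by_cases h2 : g = 0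
  · subst h2; simpa using hf h1
  exact (le_min (hf h1) (hg h2)).trans (P.ord_add' h1 h2 h T)

lemma Ge.const (c : k) : P.Ge 0 T (algebraMap k F c) := fun h => by
  rw [P.ord_const' (by rintro rfl; simp at h)]

lemma Ge.neg (hf : P.Ge n T f) : P.Ge n T (-f) := by
  have := (Ge.const (P := P) (T := T) (-1 : k)).mul hf
  simpa using this

lemma Ge.sub (hf : P.Ge n T f) (hg : P.Ge n T g) : P.Ge n T (f - g) := by
  rw [sub_eq_add_neg]; exact hf.add hg.neg

lemma Ge.const_mul (c : k) (hf : P.Ge n T f) : P.Ge n T (algebraMap k F c * f) := by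
  simpa using (Ge.const c).mul hf

lemma ge_iff (hf : f ≠ 0) : P.Ge n T f ↔ n ≤ P.ord f T := ⟨fun h => h hf, fun h _ => h⟩

lemma ge_ord (f : F) : P.Ge (P.ord f T) T f := fun _ => le_rfl

variable (P) in
lemma ord_mul (hf : f ≠ 0) (hg : g ≠ 0) (T : X) : P.ord (f * g) T = P.ord f T + P.ord g T :=
  P.ord_mul' hf hg T

variable (P) in
lemma ord_const {c : k} (hc : c ≠ 0) (T : X) : P.ord (algebraMap k F c) T = 0 :=
  P.ord_const' hc T

variable (P) in
lemma ord_one (T : X) : P.ord (1 : F) T = 0 := by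
  simpa using P.ord_const (one_ne_zero (α := k)) T

variable (P) in
lemma ord_inv (hf : f ≠ 0) (T : X) : P.ord f⁻¹ T = -P.ord f T := by
  have := P.ord_mul hf (inv_ne_zero hf) T
  rw [mul_inv_cancel₀ hf, ord_one] at this
  omega

variable (P) in
lemma ord_pow (hf : f ≠ 0) (j : ℕ) (T : X) : P.ord (f ^ j) T = j * P.ord f T := by
  induction j with
  | zero => simp [ord_one]
  | succ j ih => rw [pow_succ, P.ord_mul (pow_ne_zero _ hf) hf, ih]; push_cast; ring

lemma Ge.pow (hf : P.Ge n T f) (j : ℕ) : P.Ge (j * n) T (f ^ j) := by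
  induction j with
  | zero => simpa using Ge.const (P := P) (T := T) (1 : k)
  | succ j ih => rw [pow_succ]; convert ih.mul hf using 1; push_cast; ring

/-- The order of a sum whose second term vanishes to higher order. -/
lemma ord_add_eq (hf : f ≠ 0) (hg : P.Ge (P.ord f T + 1) T g) :
    f + g ≠ 0 ∧ P.ord (f + g) T = P.ord f T := by
  have h0 : f + g ≠ 0 := by
    intro h
    have hg' : g = -f := by linear_combination h
    have h1 := hg.neg
    rw [hg', neg_neg] at h1
    have := h1 hf
    omega
  refine ⟨h0, le_antisymm ?_ (((ge_ord f).add (hg.of_le (by omega))) h0)⟩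
  by_contra! h
  have h1 : P.Ge (P.ord f T + 1) T (f + g) := fun _ => by omega
  have h2 := h1.sub hg
  rw [add_sub_cancel_right] at h2
  have := h2 hf
  omega

/-- Leading terms: the quotient of two functions of the same order at `T` has a value at `T`. -/
lemma exists_ge_sub (hg : g ≠ 0) (hf : P.Ge (P.ord g T) T f) :
    ∃ c : k, P.Ge (P.ord g T + 1) T (f - algebraMap k F c * g) := by
  by_cases h : f = 0
  · exact ⟨0, by simpa [h] using Ge.zero⟩
  have h1 : 0 ≤ P.ord (f / g) T := by
    rw [div_eq_mul_inv, P.ord_mul h (inv_ne_zero hg), P.ord_inv hg]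
    have := hf h
    omega
  obtain ⟨c, hc⟩ := P.exists_residue' (div_ne_zero h hg) T h1
  refine ⟨c, ?_⟩
  have h2 := Ge.mul (P := P) (n := 1) hc (ge_ord (T := T) g)
  rw [sub_mul, div_mul_cancel₀ _ hg] at h2
  exact h2.of_le (by omega)

/-! ### Riemann-Roch spaces -/

variable (P)

/-- The Riemann-Roch space `L(D)`. -/
def L (D : X →₀ ℤ) : Submodule k F where
  carrier := {h | ∀ T, P.Ge (-D T) T h}
  zero_mem' _ := Ge.zero
  add_mem' ha hb T := (ha T).add (hb T)
  smul_mem' c h hh T := by rw [Algebra.smul_def]; exact (hh T).const_mul c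

variable {P} in
lemma mem_L {D : X →₀ ℤ} {h : F} : h ∈ P.L D ↔ ∀ T, P.Ge (-D T) T h := Iff.rfl

/-- The degree of a divisor. -/
noncomputable def deg : (X →₀ ℤ) →+ ℤ := Finsupp.liftAddHom fun _ => AddMonoidHom.id ℤ

@[simp]
lemma deg_single (T : X) (n : ℤ) : deg (Finsupp.single T n) = n := by simp [deg]

lemma span_eq_L (D : X →₀ ℤ) :
    Submodule.span k {h : F | h ≠ 0 → ∀ T, 0 ≤ P.ord h T + D T} = P.L D := by
  rw [← Submodule.span_eq (P.L D)]
  congr 1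
  ext h
  refine ⟨fun H T h0 => ?_, fun H h0 T => ?_⟩
  · have := H h0 T; omega
  · have := H T h0; omega

lemma deg_le_finrank (D : X →₀ ℤ) : deg D ≤ (Module.finrank k (P.L D) : ℤ) := by
  rw [← span_eq_L]; exact P.riemann_inequality' D

lemma exists_deg_eq : ∃ D : X →₀ ℤ, deg D = (Module.finrank k (P.L D) : ℤ) := by
  obtain ⟨D, hD⟩ := P.exists_deg_eq'
  exact ⟨D, by rw [← span_eq_L]; exact hD⟩

/-- The divisor of a nonzero function. -/
noncomputable def div (f : F) (hf : f ≠ 0) : X →₀ ℤ :=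
  Finsupp.ofSupportFinite (P.ord f) (P.finite_support' hf)

@[simp]
lemma div_apply (hf : f ≠ 0) (T : X) : P.div f hf T = P.ord f T := rfl

/-- Multiplication by `g` identifies `L(D)` with `L(D - div g)`. -/
lemma finrank_L_sub_div (D : X →₀ ℤ) (hg : g ≠ 0) :
    Module.finrank k (P.L (D - P.div g hg)) = Module.finrank k (P.L D) := by
  have hinj : Function.Injective (LinearMap.mulLeft k g) := fun a b h =>
    mul_left_cancel₀ hg (by simpa using h)
  have h : P.L (D - P.div g hg) = (P.L D).map (LinearMap.mulLeft k g) := by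
    ext h
    simp only [Submodule.mem_map, LinearMap.mulLeft_apply]
    constructor
    · refine fun H => ⟨g⁻¹ * h, fun T => ?_, by field_simp⟩
      refine ((ge_ord g⁻¹).mul (H T)).of_le ?_
      simp [P.ord_inv hg]
    · rintro ⟨h, H, rfl⟩ T
      refine ((ge_ord g).mul (H T)).of_le ?_
      simp
  rw [h, (Submodule.equivMapOfInjective _ hinj (P.L D)).finrank_eq]

/-- Principal divisors have degree zero: a power of a function whose divisor has nonzero degree
would identify `L(0)` with spaces `L(D)` of unbounded degree, against Riemann's inequality. -/
lemma deg_div (hf : f ≠ 0) : deg (P.div f hf) = 0 := by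
  have key : ∀ (g : F) (hg : g ≠ 0), 0 ≤ deg (P.div g hg) := by
    intro g hg
    by_contra! hneg
    set N := Module.finrank k (P.L 0) with hN
    have h1 : P.div (g ^ (N + 1)) (pow_ne_zero _ hg) = (N + 1) • P.div g hg := by
      ext T; simp [P.ord_pow hg]
    have h2 := P.deg_le_finrank (0 - P.div (g ^ (N + 1)) (pow_ne_zero _ hg))
    rw [finrank_L_sub_div, ← hN, h1, map_sub, map_nsmul, map_zero, nsmul_eq_mul] at h2
    push_cast at h2
    nlinarith
  refine le_antisymm ?_ (key f hf)
  have h := key f⁻¹ (inv_ne_zero hf)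
  have h1 : P.div f⁻¹ (inv_ne_zero hf) = -P.div f hf := by
    ext T; simp [P.ord_inv hf]
  rw [h1, map_neg] at h
  omega

lemma deg_nonneg {D : X →₀ ℤ} (hD : ∀ T, 0 ≤ D T) : 0 ≤ deg D := by
  simp only [deg, Finsupp.liftAddHom_apply]
  exact Finsupp.sum_nonneg fun T _ => hD T

lemma eq_zero_of_deg_eq_zero {D : X →₀ ℤ} (hD : ∀ T, 0 ≤ D T) (h : deg D = 0) : D = 0 := by
  by_contra hne
  obtain ⟨T, hT⟩ := Finsupp.ne_iff.1 hne
  have h1 : 0 ≤ deg (D - Finsupp.single T 1) := deg_nonneg fun S => by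
    have := hD S
    have := hD T
    simp only [Finsupp.coe_zero, Pi.zero_apply] at hT
    by_cases hS : T = S
    · subst hS; simp; omega
    · simpa [hS]
  rw [map_sub, deg_single, h] at h1
  omega

/-- An effective divisor of degree one is a point. -/
lemma exists_eq_single {D : X →₀ ℤ} (hD : ∀ T, 0 ≤ D T) (h : deg D = 1) :
    ∃ T, D = Finsupp.single T 1 := by
  have hne : D ≠ 0 := by rintro rfl; simp at h
  obtain ⟨T, hT⟩ := Finsupp.ne_iff.1 hne
  refine ⟨T, sub_eq_zero.1 (eq_zero_of_deg_eq_zero (fun S => ?_) (by simp [h]))⟩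
  have := hD S
  have := hD T
  simp only [Finsupp.coe_zero, Pi.zero_apply] at hT
  by_cases hS : T = S
  · subst hS; simp; omega
  · simpa [hS]

/-- A function without poles that has a zero vanishes identically. -/
lemma eq_zero_of_ge_one (h : ∀ S, P.Ge 0 S f) (h1 : P.Ge 1 T f) : f = 0 := by
  by_contra hf
  have h2 := eq_zero_of_deg_eq_zero (D := P.div f hf) (fun S => h S hf) (P.deg_div hf)
  have h3 : P.ord f T = 0 := congr($h2 T)
  have := h1 hf
  omega

/-- A function without poles is constant. -/
lemma eq_const (T : X) (h : ∀ S, P.Ge 0 S f) : ∃ c : k, f = algebraMap k F c := by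
  obtain ⟨c, hc⟩ := exists_ge_sub (P := P) (T := T) (f := f) one_ne_zero
    ((h T).of_le (by rw [ord_one]))
  refine ⟨c, sub_eq_zero.1 (P.eq_zero_of_ge_one (T := T) (fun S => (h S).sub (Ge.const c)) ?_)⟩
  simpa [ord_one] using hc

lemma L_zero (T : X) : P.L 0 = Submodule.span k {1} := by
  ext h
  rw [Submodule.mem_span_singleton, mem_L]
  constructor
  · intro H
    obtain ⟨c, rfl⟩ := P.eq_const T fun S => by simpa using H S
    exact ⟨c, by rw [Algebra.smul_def, mul_one]⟩
  · rintro ⟨c, rfl⟩ S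
    rw [Algebra.smul_def, mul_one]
    exact (Ge.const c).of_le (by simp)

lemma L_mono {D D' : X →₀ ℤ} (h : ∀ T, D T ≤ D' T) : P.L D ≤ P.L D' :=
  fun f hf T => (hf T).of_le (by have := h T; omega)

/-- Allowing one more pole enlarges `L(D)` by at most one dimension. -/
lemma exists_L_add_single (D : X →₀ ℤ) (T : X) :
    ∃ f : F, P.L (D + Finsupp.single T 1) ≤ P.L D ⊔ Submodule.span k {f} := by
  by_cases h : ∃ f ∈ P.L (D + Finsupp.single T 1), f ∉ P.L D
  · obtain ⟨f, hf, hf'⟩ := h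
    refine ⟨f, fun g hg => ?_⟩
    have hS (h : F) (hh : h ∈ P.L (D + Finsupp.single T 1)) (h1 : P.Ge (-D T) T h) : h ∈ P.L D := by
      intro S
      by_cases hST : T = S
      · rwa [← hST]
      · simpa [hST] using hh S
    have hne : f ≠ 0 := by rintro rfl; exact hf' (zero_mem _)
    have hord : P.ord f T = -D T - 1 := by
      have h1 := hf T hne
      by_contra h2
      refine hf' (hS f hf fun _ => ?_)
      simp only [Finsupp.add_apply, Finsupp.single_eq_same] at h1
      omega
    obtain ⟨c, hc⟩ := exists_ge_sub (P := P) (T := T) hne (f := g)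
      ((hg T).of_le (by simp [hord]; omega))
    have h1 : g - c • f ∈ P.L D :=
      hS _ (sub_mem hg (Submodule.smul_mem _ c hf)) (by
        rw [Algebra.smul_def]; exact hc.of_le (by omega))
    rw [Submodule.mem_sup]
    exact ⟨_, h1, c • f, Submodule.smul_mem _ c (Submodule.mem_span_singleton_self f), by simp⟩
  · push Not at h
    exact ⟨0, fun g hg => Submodule.mem_sup_left (h g hg)⟩

lemma finite_L_add_single (D : X →₀ ℤ) (T : X) [Module.Finite k (P.L D)] :
    Module.Finite k (P.L (D + Finsupp.single T 1)) ∧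
      Module.finrank k (P.L (D + Finsupp.single T 1)) ≤ Module.finrank k (P.L D) + 1 := by
  obtain ⟨f, hf⟩ := P.exists_L_add_single D T
  have : FiniteDimensional k (Submodule.span k {f}) :=
    FiniteDimensional.span_of_finite k (Set.finite_singleton f)
  refine ⟨Submodule.finiteDimensional_of_le hf, (Submodule.finrank_mono hf).trans ?_⟩
  refine (Submodule.finrank_add_le_finrank_add_finrank _ _).trans ?_
  gcongr
  simpa using finrank_span_le_card (R := k) ({f} : Set F)

lemma finite_L_single (T : X) (n : ℕ) : Module.Finite k (P.L (Finsupp.single T (n : ℤ))) := by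
  induction n with
  | zero =>
    have h : (Finsupp.single T ((0 : ℕ) : ℤ)) = 0 := by simp
    rw [h, P.L_zero T]
    exact FiniteDimensional.span_of_finite k (Set.finite_singleton _)
  | succ n ih =>
    have := (P.finite_L_add_single (Finsupp.single T (n : ℤ)) T).1
    rwa [← Finsupp.single_add] at this

lemma finrank_L_zero (T : X) : Module.finrank k (P.L 0) = 1 := by
  rw [P.L_zero T]; exact finrank_span_singleton one_ne_zero

/-- No function has a simple pole as its only pole. Otherwise all points would be linearly
equivalent, and the powers of that function would give `ℓ(D) > deg D` for all `D` of degree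
`≥ 0`. -/
lemma ge_of_ge_neg_one (T : X) (h : ∀ S, S ≠ T → P.Ge 0 S f) (h1 : P.Ge (-1) T f) :
    P.Ge 0 T f := by
  by_contra hcon
  have hf0 : f ≠ 0 := by rintro rfl; exact hcon Ge.zero
  have hord : P.ord f T = -1 := by
    have := h1 hf0
    by_contra h2
    exact hcon fun _ => by omega
  -- every point is linearly equivalent to `T`
  have hpt (S : X) : ∃ (g : F) (hg : g ≠ 0),
      P.div g hg = Finsupp.single S 1 - Finsupp.single T 1 := by
    by_cases hST : S = T
    · exact ⟨1, one_ne_zero, by subst hST; ext; simp [ord_one]⟩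
    obtain ⟨c, hc⟩ := exists_ge_sub (P := P) (T := S) (f := f) one_ne_zero
      ((h S hST).of_le (by rw [ord_one]))
    simp only [ord_one, mul_one, zero_add] at hc
    obtain ⟨hg, hgT⟩ := ord_add_eq (P := P) (T := T) (g := -algebraMap k F c) hf0
      ((Ge.const c).neg.of_le (by omega))
    rw [← sub_eq_add_neg] at hg hgT
    refine ⟨_, hg, ?_⟩
    rw [← sub_eq_zero]
    refine eq_zero_of_deg_eq_zero (fun R => ?_) (by simp [P.deg_div hg])
    simp only [Finsupp.sub_apply, div_apply]
    by_cases hR : R = T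
    · subst hR
      simp [hgT, hord, hST]
    · rw [Finsupp.single_eq_of_ne hR]
      by_cases hR' : R = S
      · subst hR'
        have := hc hg
        simp; omega
      · rw [Finsupp.single_eq_of_ne hR']
        have := ((h R hR).sub (Ge.const c)) hg
        omega
  have hlin (D : X →₀ ℤ) : ∃ (g : F) (hg : g ≠ 0), P.div g hg = D - Finsupp.single T (deg D) := by
    induction D using Finsupp.induction_linear with
    | zero => exact ⟨1, one_ne_zero, by ext; simp [ord_one]⟩
    | add D D' h h' =>
      obtain ⟨g, hg, h⟩ := h
      obtain ⟨g', hg', h'⟩ := h'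
      refine ⟨g * g', mul_ne_zero hg hg', ?_⟩
      have : P.div (g * g') (mul_ne_zero hg hg') = P.div g hg + P.div g' hg' := by
        ext S; simp [P.ord_mul hg hg']
      rw [this, h, h', map_add, Finsupp.single_add]
      abel
    | single S n =>
      obtain ⟨g, hg, h⟩ := hpt S
      have : ∀ n : ℕ, P.div (g ^ n) (pow_ne_zero _ hg) =
          Finsupp.single S (n : ℤ) - Finsupp.single T (n : ℤ) := fun n => by
        have h2 : P.div (g ^ n) (pow_ne_zero _ hg) = n • P.div g hg := by
          ext; simp [P.ord_pow hg]
        rw [h2, h]; simp [smul_sub]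
      rw [deg_single]
      obtain ⟨m, rfl | rfl⟩ := n.eq_nat_or_neg
      · exact ⟨_, _, this m⟩
      · refine ⟨(g ^ m)⁻¹, inv_ne_zero (pow_ne_zero _ hg), ?_⟩
        have h2 : P.div (g ^ m)⁻¹ (inv_ne_zero (pow_ne_zero _ hg)) =
            -P.div (g ^ m) (pow_ne_zero _ hg) := by
          ext; simp [P.ord_inv (pow_ne_zero _ hg)]
        rw [h2, this, Finsupp.single_neg, Finsupp.single_neg]; abel
  have hdim (n : ℕ) : n + 1 ≤ Module.finrank k (P.L (Finsupp.single T (n : ℤ))) := by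
    induction n with
    | zero =>
      have h : (Finsupp.single T ((0 : ℕ) : ℤ)) = 0 := by simp
      rw [h, P.finrank_L_zero T]
    | succ n ih =>
      have := P.finite_L_single T (n + 1)
      refine Nat.succ_le_of_lt (ih.trans_lt (Submodule.finrank_lt_finrank_of_lt ?_))
      refine lt_of_le_of_ne (P.L_mono fun S => ?_) fun heq => ?_
      · by_cases hS : T = S <;> simp [hS]
      · have hmem : f ^ (n + 1) ∈ P.L (Finsupp.single T ((n + 1 : ℕ) : ℤ)) := by
          intro S
          by_cases hS : S = T
          · subst hS
            exact (h1.pow (n + 1)).of_le (by simp)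
          · refine ((h S hS).pow (n + 1)).of_le ?_
            rw [Finsupp.single_eq_of_ne hS]; simp
        rw [← heq] at hmem
        have := hmem T (pow_ne_zero _ hf0)
        rw [P.ord_pow hf0, hord] at this
        simp at this
  obtain ⟨D, hD⟩ := P.exists_deg_eq
  obtain ⟨g, hg, hgD⟩ := hlin D
  have h2 := P.finrank_L_sub_div D hg
  have h3 : D - P.div g hg = Finsupp.single T (Module.finrank k (P.L D) : ℤ) := by
    rw [hgD, hD]; abel
  rw [h3] at h2
  have := hdim (Module.finrank k (P.L D))
  omega

end FunctionField

namespace FunctionField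

variable {k F X : Type*} [Field k] [Field F] [Algebra k F] (P : FunctionField k F X)

/-! ### The group structure on the set of points -/

/-- Divisors that become principal after subtracting a multiple of `O`. -/
def principal (O : X) : AddSubgroup (X →₀ ℤ) where
  carrier := {D | ∃ (f : F) (hf : f ≠ 0), P.div f hf = D - Finsupp.single O (deg D)}
  zero_mem' := ⟨1, one_ne_zero, by ext; simp [ord_one]⟩
  add_mem' := by
    rintro D D' ⟨g, hg, h⟩ ⟨g', hg', h'⟩
    refine ⟨g * g', mul_ne_zero hg hg', ?_⟩
    have : P.div (g * g') (mul_ne_zero hg hg') = P.div g hg + P.div g' hg' := by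
      ext S; simp [P.ord_mul hg hg']
    rw [this, h, h', map_add, Finsupp.single_add]
    abel
  neg_mem' := by
    rintro D ⟨g, hg, h⟩
    refine ⟨g⁻¹, inv_ne_zero hg, ?_⟩
    have : P.div g⁻¹ (inv_ne_zero hg) = -P.div g hg := by
      ext S; simp [P.ord_inv hg]
    rw [this, h, map_neg, Finsupp.single_neg]
    abel

/-- The group of divisor classes modulo the class of the point `O`. Every class contains a unique
divisor class of degree zero, so this is `Pic⁰`. -/
abbrev Pic (O : X) : Type _ := (X →₀ ℤ) ⧸ P.principal O

/-- The class of a point `T` modulo `O`, corresponding to the class of `T - O` in `Pic⁰`. -/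
noncomputable def pt (O T : X) : P.Pic O := QuotientAddGroup.mk (Finsupp.single T 1)

variable {P} {O T S : X} {f g : F}

lemma mk_eq_zero {D : X →₀ ℤ} : (QuotientAddGroup.mk D : P.Pic O) = 0 ↔
    ∃ (f : F) (hf : f ≠ 0), P.div f hf = D - Finsupp.single O (deg D) :=
  QuotientAddGroup.eq_zero_iff D

lemma pt_self : P.pt O O = 0 := mk_eq_zero.2 ⟨1, one_ne_zero, by ext; simp [ord_one]⟩

lemma pt_injective : Function.Injective (P.pt O) := by
  intro S T h
  rw [pt, pt, QuotientAddGroup.eq, ← QuotientAddGroup.eq_zero_iff, mk_eq_zero] at h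
  obtain ⟨f, hf, h⟩ := h
  simp only [map_add, map_neg, deg_single, neg_add_cancel, Finsupp.single_zero, sub_zero] at h
  by_contra hne
  have hord (R : X) : P.ord f R = -Finsupp.single S (1 : ℤ) R + Finsupp.single T 1 R := congr($h R)
  have h0 : P.Ge 0 S f := by
    refine P.ge_of_ge_neg_one S (fun R hR _ => ?_) fun _ => ?_
    · rw [hord, Finsupp.single_eq_of_ne hR]
      by_cases hRT : R = T
      · subst hRT; simp
      · simp [Finsupp.single_eq_of_ne hRT]
    · rw [hord]; simp [hne]
  have := h0 hf
  rw [hord] at this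
  simp [hne] at this

/-- Every class is the class of a point: a divisor of degree one has a nonzero section. -/
lemma pt_surjective : Function.Surjective (P.pt O) := by
  intro D
  obtain ⟨D, rfl⟩ := QuotientAddGroup.mk_surjective D
  set D' := D + Finsupp.single O (1 - deg D) with hD'
  have hdeg : deg D' = 1 := by simp [hD']
  have h1 := P.deg_le_finrank D'
  rw [hdeg] at h1
  have h2 : P.L D' ≠ ⊥ := fun h => by rw [h, finrank_bot] at h1; simp at h1
  obtain ⟨f, hf, hf0⟩ := Submodule.exists_mem_ne_zero_of_ne_bot h2
  obtain ⟨T, hT⟩ := exists_eq_single (D := D' + P.div f hf0) (fun S => by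
    have := hf S hf0
    simp only [Finsupp.add_apply, div_apply]
    omega) (by rw [map_add, hdeg, P.deg_div, add_zero])
  refine ⟨T, ?_⟩
  rw [pt, eq_comm, QuotientAddGroup.eq, ← QuotientAddGroup.eq_zero_iff, mk_eq_zero]
  refine ⟨f, hf0, ?_⟩
  rw [← hT, map_add, map_neg, map_add, hdeg, P.deg_div, add_zero, hD',
    show -deg D + 1 = 1 - deg D by ring]
  abel

/-- The group of classes is in bijection with the points of the curve. -/
noncomputable def ptEquiv (P : FunctionField k F X) (O : X) : X ≃ P.Pic O :=
  Equiv.ofBijective (P.pt O) ⟨pt_injective, pt_surjective⟩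

lemma pt_ne_zero (h : T ≠ O) : P.pt O T ≠ 0 := fun h' => h (pt_injective (h'.trans pt_self.symm))

/-! ### Zeros of functions with a single pole -/

section Zeros

variable [DecidableEq X]

variable (P O) in
/-- `f` has no pole outside `O`, does not vanish at `O`, and `s` is the multiset of its zeros. -/
structure HasZeros (f : F) (s : Multiset X) : Prop where
  ne_zero : f ≠ 0
  notMem : O ∉ s
  ord_eq : ∀ T ≠ O, P.ord f T = s.count T
  ord_base : P.ord f O = -s.card

lemma exists_multiset {D : X →₀ ℤ} (hD : ∀ T, 0 ≤ D T) :
    ∃ s : Multiset X, (∀ T, D T = s.count T) ∧ deg D = s.card := by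
  refine ⟨Finsupp.toMultiset (D.mapRange Int.toNat rfl), fun T => ?_, ?_⟩
  · simp [hD T]
  · rw [Finsupp.card_toMultiset, Finsupp.sum_mapRange_index (by simp)]
    simp only [deg, Finsupp.liftAddHom_apply, Finsupp.sum, AddMonoidHom.id_apply, Nat.cast_sum]
    exact Finset.sum_congr rfl fun T _ => by simp [hD T]

/-- A function without poles outside `O` vanishes at as many points as the order of its pole. -/
lemma exists_hasZeros (hf : f ≠ 0) (h : ∀ T ≠ O, P.Ge 0 T f) : ∃ s, P.HasZeros O f s := by
  obtain ⟨s, hs, hs'⟩ := exists_multiset (D := P.div f hf - Finsupp.single O (P.ord f O))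
    fun T => by
      by_cases hT : T = O
      · subst hT; simp
      · simpa [Finsupp.single_eq_of_ne hT] using h T hT hf
  rw [map_sub, P.deg_div, deg_single] at hs'
  refine ⟨s, hf, fun hO => ?_, fun T hT => ?_, by omega⟩
  · have := hs O
    simp only [Finsupp.sub_apply, div_apply, Finsupp.single_eq_same, sub_self] at this
    have := Multiset.count_pos.2 hO
    omega
  · have := hs T
    simpa [Finsupp.single_eq_of_ne hT] using this

namespace HasZeros

variable {s t : Multiset X}

lemma mul (hf : P.HasZeros O f s) (hg : P.HasZeros O g t) : P.HasZeros O (f * g) (s + t) where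
  ne_zero := mul_ne_zero hf.ne_zero hg.ne_zero
  notMem := by simp [hf.notMem, hg.notMem]
  ord_eq T hT := by
    rw [P.ord_mul hf.ne_zero hg.ne_zero, hf.ord_eq T hT, hg.ord_eq T hT]; simp
  ord_base := by
    rw [P.ord_mul hf.ne_zero hg.ne_zero, hf.ord_base, hg.ord_base]; simp; ring

lemma neg (hf : P.HasZeros O f s) : P.HasZeros O (-f) s := by
  have h : (-f) = algebraMap k F (-1) * f := by simp
  have h1 : (-1 : k) ≠ 0 := by simp
  refine ⟨neg_ne_zero.2 hf.ne_zero, hf.notMem, fun T hT => ?_, ?_⟩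
  · rw [h, P.ord_mul (by simp) hf.ne_zero, P.ord_const h1, hf.ord_eq T hT, zero_add]
  · rw [h, P.ord_mul (by simp) hf.ne_zero, P.ord_const h1, hf.ord_base, zero_add]

/-- The zeros of a multiple contain the zeros of a divisor. -/
lemma le_of_mul_eq (hf : P.HasZeros O f s) (hg : P.HasZeros O g t) {h : F}
    (hh : ∀ T ≠ O, P.Ge 0 T h) (e : f * h = g) : s ≤ t := by
  rw [Multiset.le_iff_count]
  intro T
  by_cases hT : T = O
  · rw [hT, Multiset.count_eq_zero.2 hf.notMem]; exact Nat.zero_le _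
  have h0 : h ≠ 0 := by rintro rfl; exact hg.ne_zero (by simp [← e])
  have h1 := P.ord_mul hf.ne_zero h0 T
  rw [e, hf.ord_eq T hT, hg.ord_eq T hT] at h1
  have := hh T hT h0
  omega

lemma unique (hf : P.HasZeros O f s) (hg : P.HasZeros O f t) : s = t := by
  ext T
  by_cases hT : T = O
  · rw [hT, Multiset.count_eq_zero.2 hf.notMem, Multiset.count_eq_zero.2 hg.notMem]
  · have h1 := hf.ord_eq T hT
    rw [hg.ord_eq T hT] at h1
    omega

lemma mem_iff (hf : P.HasZeros O f s) (hT : T ≠ O) : T ∈ s ↔ P.Ge 1 T f := by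
  rw [ge_iff hf.ne_zero, hf.ord_eq T hT, ← Multiset.count_pos]
  omega

lemma ne_base (hf : P.HasZeros O f s) (hT : T ∈ s) : T ≠ O := by
  rintro rfl; exact hf.notMem hT

/-- The zeros of a function with poles only at `O` add up to zero. -/
lemma sum_eq_zero (hf : P.HasZeros O f s) : (s.map (P.pt O)).sum = 0 := by
  set D : X →₀ ℤ := (s.map fun T => Finsupp.single T (1 : ℤ)).sum with hD
  have h1 : (s.map (P.pt O)).sum = (QuotientAddGroup.mk D : P.Pic O) := by
    rw [hD, ← QuotientAddGroup.mk'_apply, map_multiset_sum, Multiset.map_map]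
    rfl
  have h2 : deg D = s.card := by
    rw [hD, map_multiset_sum, Multiset.map_map]
    simp
  have h3 (T : X) : D T = s.count T := by
    rw [hD]
    clear_value D
    clear h1 h2 hD hf
    induction s using Multiset.induction with
    | empty => simp
    | cons a s ih =>
      rw [Multiset.map_cons, Multiset.sum_cons, Finsupp.add_apply, ih, Multiset.count_cons,
        Finsupp.single_apply]
      by_cases h : a = T
      · subst h; simp [add_comm]
      · simp [h, Ne.symm h]
  rw [h1, mk_eq_zero]
  refine ⟨f, hf.ne_zero, ?_⟩
  ext T
  rw [Finsupp.sub_apply, h3, h2, div_apply]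
  by_cases hT : T = O
  · subst hT
    simp [hf.ord_base, Multiset.count_eq_zero.2 hf.notMem]
  · simp [hf.ord_eq T hT, Finsupp.single_eq_of_ne hT]

lemma pt_add_pt {A B : X} (hf : P.HasZeros O f {A, B}) : P.pt O A + P.pt O B = 0 := by
  simpa using hf.sum_eq_zero

lemma pt_add_pt_add_pt {A B C : X} (hf : P.HasZeros O f {A, B, C}) :
    P.pt O A + P.pt O B + P.pt O C = 0 := by
  simpa [add_assoc] using hf.sum_eq_zero

end HasZeros

end Zeros

/-! ### Values of functions -/

variable (P) in
/-- `P.Val T f c`: the function `f` is regular at `T`, with value `c`. -/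
def Val (T : X) (f : F) (c : k) : Prop := P.Ge 1 T (f - algebraMap k F c)

variable {c d : k}

lemma exists_val (h : P.Ge 0 T f) : ∃ c, P.Val T f c := by
  obtain ⟨c, hc⟩ := exists_ge_sub (P := P) (T := T) (f := f) one_ne_zero
    (h.of_le (by rw [ord_one]))
  exact ⟨c, by simpa [ord_one, Val] using hc⟩

namespace Val

lemma ge (h : P.Val T f c) : P.Ge 0 T f := by
  have := (h.of_le zero_le_one).add (Ge.const c)
  simpa using this

lemma const (c : k) : P.Val T (algebraMap k F c) c := by
  rw [Val, sub_self]; exact Ge.zero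

lemma add (hf : P.Val T f c) (hg : P.Val T g d) : P.Val T (f + g) (c + d) := by
  have := Ge.add hf hg
  rw [Val, map_add]; convert this using 1; ring

lemma sub (hf : P.Val T f c) (hg : P.Val T g d) : P.Val T (f - g) (c - d) := by
  have := Ge.sub hf hg
  rw [Val, map_sub]; convert this using 1; ring

lemma neg (hf : P.Val T f c) : P.Val T (-f) (-c) := by
  have := Ge.neg hf
  rw [Val, map_neg]; convert this using 1; ring

lemma mul (hf : P.Val T f c) (hg : P.Val T g d) : P.Val T (f * g) (c * d) := by
  have h1 := Ge.add (Ge.mul hf hg.ge) (Ge.const_mul c hg)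
  rw [Val, map_mul]; rw [add_zero] at h1; convert h1 using 1; ring

lemma pow (hf : P.Val T f c) (n : ℕ) : P.Val T (f ^ n) (c ^ n) := by
  induction n with
  | zero => simpa using Val.const (P := P) (T := T) (1 : k)
  | succ n ih => rw [pow_succ, pow_succ]; exact ih.mul hf

lemma unique (hf : P.Val T f c) (hg : P.Val T f d) : c = d := by
  by_contra hne
  have h : P.Ge 1 T (algebraMap k F (c - d)) := by
    have := Ge.sub hg hf
    rw [map_sub]; convert this using 1; ring
  have h1 : algebraMap k F (c - d) ≠ 0 := by simpa [sub_eq_zero] using hne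
  have := h h1
  rw [P.ord_const (sub_ne_zero.2 hne)] at this
  omega

lemma inv (hf : P.Val T f c) (hc : c ≠ 0) : P.Val T f⁻¹ c⁻¹ := by
  have hc' : algebraMap k F c ≠ 0 := by simpa using hc
  obtain ⟨h0, h1⟩ := ord_add_eq (P := P) (T := T) (f := algebraMap k F c)
    (g := f - algebraMap k F c) hc' (by rw [P.ord_const hc]; exact hf)
  rw [add_sub_cancel, P.ord_const hc] at h1
  rw [add_sub_cancel] at h0
  have h2 : f⁻¹ - algebraMap k F c⁻¹ =
      -(f⁻¹ * algebraMap k F c⁻¹ * (f - algebraMap k F c)) := by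
    rw [map_inv₀]; field_simp; ring
  rw [Val, h2]
  refine Ge.neg (((((ge_ord f⁻¹).mul (Ge.const c⁻¹)).mul hf)).of_le ?_)
  rw [P.ord_inv h0, h1]; simp

lemma div (hf : P.Val T f c) (hg : P.Val T g d) (hd : d ≠ 0) : P.Val T (f / g) (c / d) := by
  rw [div_eq_mul_inv, div_eq_mul_inv]; exact hf.mul (hg.inv hd)

end Val

lemma val_zero_iff : P.Val T f 0 ↔ P.Ge 1 T f := by simp [Val]

open Classical in
variable (P) in
/-- The value of `f` at `T`, with the junk value `0` if `f` has a pole at `T`. -/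
noncomputable def ev (T : X) (f : F) : k := if h : ∃ c, P.Val T f c then h.choose else 0

lemma Val.ev_eq (h : P.Val T f c) : P.ev T f = c := by
  have h' : ∃ c, P.Val T f c := ⟨c, h⟩
  rw [ev, dif_pos h']
  exact h'.choose_spec.unique h

lemma val_ev (h : P.Ge 0 T f) : P.Val T f (P.ev T f) := by
  obtain ⟨c, hc⟩ := exists_val h
  rwa [hc.ev_eq]

/-- A function has a value at all but finitely many points. -/
lemma eventually_val (f : F) : ∀ᶠ T in Filter.cofinite, P.Val T f (P.ev T f) := by
  by_cases hf : f = 0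
  · subst hf; exact Filter.Eventually.of_forall fun T => val_ev Ge.zero
  filter_upwards [(P.finite_support' hf).eventually_cofinite_notMem] with T hT
  refine val_ev fun _ => ?_
  simp only [not_not] at hT
  omega

/-- A nonzero function has a nonzero value at all but finitely many points. -/
lemma eventually_ev_ne_zero (hf : f ≠ 0) : ∀ᶠ T in Filter.cofinite, P.ev T f ≠ 0 := by
  filter_upwards [(P.finite_support' hf).eventually_cofinite_notMem, eventually_val (P := P) f]
    with T hT hv h0
  simp only [not_not] at hT
  rw [h0, val_zero_iff] at hv
  have := hv hf
  omega

end FunctionField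

namespace FunctionField

variable {k F X : Type*} [Field k] [Field F] [Algebra k F]

/-! ### Weierstrass coordinates -/

/-- Weierstrass coordinates: functions `x` and `y` with poles of order two and three at `O`, and
no other poles, that satisfy a Weierstrass equation. -/
structure Weierstrass (P : FunctionField k F X) (O : X) where
  x : F
  y : F
  a₁ : k
  a₂ : k
  a₃ : k
  a₄ : k
  a₆ : k
  x_ne_zero : x ≠ 0
  y_ne_zero : y ≠ 0
  ge_x : ∀ T ≠ O, P.Ge 0 T x
  ge_y : ∀ T ≠ O, P.Ge 0 T y
  ord_x : P.ord x O = -2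
  ord_y : P.ord y O = -3
  equation : y ^ 2 + algebraMap k F a₁ * x * y + algebraMap k F a₃ * y =
    x ^ 3 + algebraMap k F a₂ * x ^ 2 + algebraMap k F a₄ * x + algebraMap k F a₆

/-- A function whose only pole is `O` may be changed by a multiple of a function with the same
property, and with a pole of the right order, so as to lower the order of its pole. -/
lemma exists_lower_pole {P : FunctionField k F X} {O : X} {f g : F} (n : ℤ) (hg : g ≠ 0)
    (hgO : P.ord g O = n) (hgT : ∀ T ≠ O, P.Ge 0 T g) (hf : P.Ge n O f)
    (hfT : ∀ T ≠ O, P.Ge 0 T f) :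
    ∃ c : k, P.Ge (n + 1) O (f - algebraMap k F c * g) ∧
      ∀ T ≠ O, P.Ge 0 T (f - algebraMap k F c * g) := by
  subst hgO
  obtain ⟨c, hc⟩ := exists_ge_sub hg hf
  exact ⟨c, hc, fun T hT => (hfT T hT).sub ((hgT T hT).const_mul c)⟩

lemma exists_mem_L_succ (P : FunctionField k F X) (O : X) (n m : ℕ)
    (hm : Module.finrank k (P.L (Finsupp.single O (m : ℤ))) ≤ n) :
    ∃ f : F, f ≠ 0 ∧ f ∉ P.L (Finsupp.single O (m : ℤ)) ∧
      (∀ T ≠ O, P.Ge 0 T f) ∧ P.Ge (-(n + 1 : ℕ)) O f := by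
  have h1 := P.deg_le_finrank (Finsupp.single O ((n + 1 : ℕ) : ℤ))
  rw [deg_single] at h1
  have hnot : ¬ P.L (Finsupp.single O ((n + 1 : ℕ) : ℤ)) ≤ P.L (Finsupp.single O (m : ℤ)) := by
    intro hle
    have := P.finite_L_single O m
    have := Submodule.finrank_mono hle
    omega
  obtain ⟨f, hf, hf'⟩ := Set.not_subset.1 hnot
  refine ⟨f, by rintro rfl; exact hf' (zero_mem _), hf', fun T hT => ?_, ?_⟩
  · exact (hf T).of_le (by simp [Finsupp.single_eq_of_ne hT])
  · exact (hf O).of_le (by simp)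

/-- Weierstrass coordinates exist: `x` and `y` are found by comparing dimensions, and the equation
is obtained from `y ^ 2` by removing the poles step by step. -/
theorem exists_weierstrass (P : FunctionField k F X) (O : X) : Nonempty (P.Weierstrass O) := by
  have hmem (f : F) (n : ℕ) (hf : ∀ T ≠ O, P.Ge 0 T f) (hO : P.Ge (-n) O f) :
      f ∈ P.L (Finsupp.single O (n : ℤ)) := by
    intro T
    by_cases hT : T = O
    · subst hT; simpa using hO
    · simpa [Finsupp.single_eq_of_ne hT] using hf T hT
  have h0 : (Finsupp.single O ((0 : ℕ) : ℤ)) = 0 := by simp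
  have hle : P.L (Finsupp.single O ((1 : ℕ) : ℤ)) ≤ P.L 0 := by
    intro f hf T
    have hT (T : X) (hT : T ≠ O) : P.Ge 0 T f := by
      simpa [Finsupp.single_eq_of_ne hT] using hf T
    by_cases h : T = O
    · subst h
      simpa using P.ge_of_ge_neg_one T hT (by simpa using hf T)
    · simpa using hT T h
  obtain ⟨x, hx0, hx, hxT, hxO⟩ := P.exists_mem_L_succ O 1 0
    (by rw [h0, P.finrank_L_zero O])
  have hxord : P.ord x O = -2 := by
    have h1 := hxO hx0
    by_contra hne
    refine hx ?_
    rw [h0]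
    refine hle (hmem _ _ hxT fun _ => ?_)
    push_cast at h1 ⊢
    omega
  have h2 : Module.finrank k (P.L (Finsupp.single O ((2 : ℕ) : ℤ))) ≤ 2 := by
    have := P.finite_L_single O 0
    rw [h0] at this
    have h1 := Submodule.finrank_mono hle
    rw [P.finrank_L_zero O] at h1
    have := P.finite_L_single O 1
    have h3 := (P.finite_L_add_single (Finsupp.single O ((1 : ℕ) : ℤ)) O).2
    rw [← Finsupp.single_add] at h3
    rw [show ((2 : ℕ) : ℤ) = ((1 : ℕ) : ℤ) + 1 by norm_num]
    exact h3.trans (Nat.succ_le_succ h1)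
  obtain ⟨y, hy0, hy, hyT, hyO⟩ := P.exists_mem_L_succ O 2 2 h2
  have hyord : P.ord y O = -3 := by
    have h1 := hyO hy0
    by_contra hne
    refine hy (hmem _ _ hyT fun _ => ?_)
    push_cast at h1 ⊢
    omega
  have hx2 : P.ord (x ^ 2) O = -4 := by rw [P.ord_pow hx0, hxord]; norm_num
  have hx3 : P.ord (x ^ 3) O = -6 := by rw [P.ord_pow hx0, hxord]; norm_num
  have hy2 : P.ord (y ^ 2) O = -6 := by rw [P.ord_pow hy0, hyord]; norm_num
  have hxy : P.ord (x * y) O = -5 := by rw [P.ord_mul hx0 hy0, hxord, hyord]; norm_num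
  have hpow {f : F} (hf : ∀ T ≠ O, P.Ge 0 T f) (n : ℕ) : ∀ T ≠ O, P.Ge 0 T (f ^ n) :=
    fun T hT => ((hf T hT).pow n).of_le (by simp)
  obtain ⟨c₆, h6, h6'⟩ := exists_lower_pole _ (pow_ne_zero 3 hx0) hx3 (hpow hxT 3)
    (fun _ => by rw [hy2]) (hpow hyT 2)
  obtain ⟨c₅, h5, h5'⟩ := exists_lower_pole _ (mul_ne_zero hx0 hy0) hxy
    (fun T hT => (hxT T hT).mul (hyT T hT)) h6 h6'
  obtain ⟨c₄, h4, h4'⟩ := exists_lower_pole _ (pow_ne_zero 2 hx0) hx2 (hpow hxT 2) h5 h5'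
  obtain ⟨c₃, h3, h3'⟩ := exists_lower_pole _ hy0 hyord hyT h4 h4'
  obtain ⟨c₂, h2, h2'⟩ := exists_lower_pole _ hx0 hxord hxT h3 h3'
  obtain ⟨c₀, h⟩ := P.eq_const O (f := y ^ 2 - algebraMap k F c₆ * x ^ 3 -
      algebraMap k F c₅ * (x * y) - algebraMap k F c₄ * x ^ 2 - algebraMap k F c₃ * y -
      algebraMap k F c₂ * x) (fun T => by
    by_cases hT : T = O
    · subst hT; exact P.ge_of_ge_neg_one T h2' h2
    · exact h2' T hT)
  have hc : c₆ ≠ 0 := by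
    rintro rfl
    have := h6 (by simpa using hy0)
    simp [P.ord_pow hy0, hyord] at this
  have hc' : algebraMap k F c₆ ≠ 0 := by simpa using hc
  refine ⟨⟨algebraMap k F c₆ * x, algebraMap k F c₆ * y, -c₅, c₄, -(c₆ * c₃), c₆ * c₂, c₆ ^ 2 * c₀,
    mul_ne_zero hc' hx0, mul_ne_zero hc' hy0, fun T hT => (hxT T hT).const_mul _,
    fun T hT => (hyT T hT).const_mul _, ?_, ?_, ?_⟩⟩
  · rw [P.ord_mul hc' hx0, P.ord_const hc, hxord]; rfl
  · rw [P.ord_mul hc' hy0, P.ord_const hc, hyord]; rfl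
  · simp only [map_neg, map_mul, map_pow]
    linear_combination (algebraMap k F c₆) ^ 2 * h

namespace Weierstrass

variable {P : FunctionField k F X} {O : X} (W : P.Weierstrass O) {T S R : X}

/-- The line `y = a x + b`. -/
def line (a b : k) : F := W.y - (algebraMap k F a * W.x + algebraMap k F b)

/-- The image of the line `y = a x + b` under the involution `y ↦ -y - a₁ x - a₃`. -/
def conjLine (a b : k) : F :=
  -W.y - algebraMap k F W.a₁ * W.x - algebraMap k F W.a₃ -
    (algebraMap k F a * W.x + algebraMap k F b)

/-- The line `x = c`. -/
def vert (c : k) : F := W.x - algebraMap k F c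

lemma ge_line (a b : k) (hT : T ≠ O) : P.Ge 0 T (W.line a b) :=
  (W.ge_y T hT).sub (((W.ge_x T hT).const_mul a).add (Ge.const b))

lemma ge_vert (c : k) (hT : T ≠ O) : P.Ge 0 T (W.vert c) := (W.ge_x T hT).sub (Ge.const c)

lemma ge_x_base : P.Ge (-2) O W.x := fun _ => by rw [W.ord_x]

lemma ord_line (a b : k) : W.line a b ≠ 0 ∧ P.ord (W.line a b) O = -3 := by
  rw [line, sub_eq_add_neg, ← W.ord_y]
  refine ord_add_eq W.y_ne_zero ?_
  rw [W.ord_y]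
  exact ((W.ge_x_base.const_mul a).add ((Ge.const b).of_le (by norm_num))).neg

lemma ord_vert (c : k) : W.vert c ≠ 0 ∧ P.ord (W.vert c) O = -2 := by
  rw [vert, sub_eq_add_neg, ← W.ord_x]
  refine ord_add_eq W.x_ne_zero ?_
  rw [W.ord_x]
  exact ((Ge.const c).of_le (by norm_num)).neg

lemma conjLine_eq (a b : k) : W.conjLine a b = -W.line (-W.a₁ - a) (-W.a₃ - b) := by
  simp only [conjLine, line, map_sub, map_neg]; ring

/-- The product of a line and its conjugate is, up to sign, a monic cubic in `x`. -/
lemma line_mul_conjLine (a b : k) : W.line a b * W.conjLine a b =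
    -(W.x ^ 3 - algebraMap k F (a ^ 2 + W.a₁ * a - W.a₂) * W.x ^ 2 -
      algebraMap k F (2 * a * b + W.a₁ * b + W.a₃ * a - W.a₄) * W.x -
      algebraMap k F (b ^ 2 + W.a₃ * b - W.a₆)) := by
  simp only [map_sub, map_add, map_mul, map_pow, map_ofNat, line, conjLine]
  linear_combination -W.equation

/-- The value of the coordinate `x` at a point. -/
noncomputable def xAt (T : X) : k := P.ev T W.x

/-- The value of the coordinate `y` at a point. -/
noncomputable def yAt (T : X) : k := P.ev T W.y

lemma val_x (hT : T ≠ O) : P.Val T W.x (W.xAt T) := val_ev (W.ge_x T hT)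

lemma val_y (hT : T ≠ O) : P.Val T W.y (W.yAt T) := val_ev (W.ge_y T hT)

lemma val_line (a b : k) (hT : T ≠ O) :
    P.Val T (W.line a b) (W.yAt T - (a * W.xAt T + b)) :=
  (W.val_y hT).sub (((Val.const a).mul (W.val_x hT)).add (Val.const b))

lemma val_conjLine (a b : k) (hT : T ≠ O) : P.Val T (W.conjLine a b)
    (-W.yAt T - W.a₁ * W.xAt T - W.a₃ - (a * W.xAt T + b)) :=
  (((W.val_y hT).neg.sub ((Val.const _).mul (W.val_x hT))).sub (Val.const _)).sub
    (((Val.const a).mul (W.val_x hT)).add (Val.const b))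

lemma val_vert (c : k) (hT : T ≠ O) : P.Val T (W.vert c) (W.xAt T - c) :=
  (W.val_x hT).sub (Val.const c)

lemma equation_at (hT : T ≠ O) :
    W.yAt T ^ 2 + W.a₁ * W.xAt T * W.yAt T + W.a₃ * W.yAt T =
      W.xAt T ^ 3 + W.a₂ * W.xAt T ^ 2 + W.a₄ * W.xAt T + W.a₆ := by
  have hx := W.val_x hT
  have hy := W.val_y hT
  have h1 := ((hy.pow 2).add (((Val.const W.a₁).mul hx).mul hy)).add ((Val.const W.a₃).mul hy)
  have h2 := (((hx.pow 3).add ((Val.const W.a₂).mul (hx.pow 2))).add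
    ((Val.const W.a₄).mul hx)).add (Val.const W.a₆)
  rw [W.equation] at h1
  exact h1.unique h2

section Zeros

variable [DecidableEq X]

lemma exists_zeros_line (a b : k) : ∃ s, P.HasZeros O (W.line a b) s ∧ s.card = 3 := by
  obtain ⟨s, hs⟩ := exists_hasZeros (W.ord_line a b).1 fun T hT => W.ge_line a b hT
  have := hs.ord_base
  rw [(W.ord_line a b).2] at this
  exact ⟨s, hs, by omega⟩

lemma exists_zeros_conjLine (a b : k) : ∃ s, P.HasZeros O (W.conjLine a b) s ∧ s.card = 3 := by
  obtain ⟨s, hs, h⟩ := W.exists_zeros_line (-W.a₁ - a) (-W.a₃ - b)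
  exact ⟨s, by rw [conjLine_eq]; exact hs.neg, h⟩

lemma exists_zeros_vert (c : k) : ∃ S T, P.HasZeros O (W.vert c) {S, T} := by
  obtain ⟨s, hs⟩ := exists_hasZeros (W.ord_vert c).1 fun T hT => W.ge_vert c hT
  have := hs.ord_base
  rw [(W.ord_vert c).2] at this
  obtain ⟨S, T, rfl⟩ := Multiset.card_eq_two.1 (show s.card = 2 by omega)
  exact ⟨S, T, hs⟩

lemma mem_zeros_line {a b : k} {s : Multiset X} (hs : P.HasZeros O (W.line a b) s) (hT : T ≠ O) :
    T ∈ s ↔ W.yAt T = a * W.xAt T + b := by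
  rw [hs.mem_iff hT, ← val_zero_iff]
  refine ⟨fun h => sub_eq_zero.1 ((W.val_line a b hT).unique h), fun h => ?_⟩
  have := W.val_line a b hT
  rwa [h, sub_self] at this

lemma mem_zeros_conjLine {a b : k} {s : Multiset X} (hs : P.HasZeros O (W.conjLine a b) s)
    (hT : T ≠ O) : T ∈ s ↔ -W.yAt T - W.a₁ * W.xAt T - W.a₃ = a * W.xAt T + b := by
  rw [hs.mem_iff hT, ← val_zero_iff]
  refine ⟨fun h => sub_eq_zero.1 ((W.val_conjLine a b hT).unique h), fun h => ?_⟩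
  have := W.val_conjLine a b hT
  rwa [h, sub_self] at this

lemma mem_zeros_vert {c : k} {s : Multiset X} (hs : P.HasZeros O (W.vert c) s) (hT : T ≠ O) :
    T ∈ s ↔ W.xAt T = c := by
  rw [hs.mem_iff hT, ← val_zero_iff]
  refine ⟨fun h => sub_eq_zero.1 ((W.val_vert c hT).unique h), fun h => ?_⟩
  have := W.val_vert c hT
  rwa [h, sub_self] at this

/-- The negative of a point lies on the same vertical line. -/
lemma exists_neg (hT : T ≠ O) : ∃ T', T' ≠ O ∧ W.xAt T' = W.xAt T ∧
    P.HasZeros O (W.vert (W.xAt T)) {T, T'} ∧ P.pt O T' = -P.pt O T := by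
  obtain ⟨A, B, h⟩ := W.exists_zeros_vert (W.xAt T)
  have hmem := (W.mem_zeros_vert h hT).2 rfl
  have : ∃ T', P.HasZeros O (W.vert (W.xAt T)) {T, T'} := by
    rcases (by simpa using hmem : T = A ∨ T = B) with rfl | rfl
    · exact ⟨B, h⟩
    · exact ⟨A, by rwa [Multiset.pair_comm]⟩
  obtain ⟨T', h⟩ := this
  have hT' : T' ≠ O := h.ne_base (by simp)
  refine ⟨T', hT', (W.mem_zeros_vert h hT').1 (by simp), h, ?_⟩
  have := h.pt_add_pt
  exact eq_neg_of_add_eq_zero_right this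

lemma exists_xAt_eq (c : k) : ∃ T, T ≠ O ∧ W.xAt T = c := by
  obtain ⟨A, B, h⟩ := W.exists_zeros_vert c
  have hA : A ≠ O := h.ne_base (by simp)
  exact ⟨A, hA, (W.mem_zeros_vert h hA).1 (by simp)⟩

lemma pt_eq_or_eq_neg (hT : T ≠ O) (hS : S ≠ O) (h : W.xAt S = W.xAt T) :
    P.pt O S = P.pt O T ∨ P.pt O S = -P.pt O T := by
  obtain ⟨T', -, -, h', hn⟩ := W.exists_neg hT
  have := (W.mem_zeros_vert h' hS).2 h
  rcases (by simpa using this : S = T ∨ S = T') with rfl | rfl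
  · exact Or.inl rfl
  · exact Or.inr hn

lemma not_le_zeros_line {a b : k} {s : Multiset X} (hs : P.HasZeros O (W.line a b) s)
    (hcard : s.card = 3) (h : P.pt O S + P.pt O T = 0) : ¬ ({S, T} : Multiset X) ≤ s := by
  intro hle
  obtain ⟨u, rfl⟩ := Multiset.le_iff_exists_add.1 hle
  simp only [Multiset.card_add, Multiset.card_pair] at hcard
  obtain ⟨R, rfl⟩ := Multiset.card_eq_one.1 (show u.card = 1 by omega)
  have h1 := hs.sum_eq_zero
  simp only [Multiset.map_add, Multiset.insert_eq_cons, Multiset.map_cons,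
    Multiset.map_singleton, Multiset.sum_add, Multiset.sum_cons, Multiset.sum_singleton, h,
    zero_add] at h1
  exact pt_ne_zero (hs.ne_base (by simp)) h1

/-- The negative of a point on a line lies on the conjugate line. -/
lemma neg_mem_conjLine {a b : k} (hT : T ≠ O) (h : W.yAt T = a * W.xAt T + b) {T' : X}
    (hT' : T' ≠ O) (hneg : P.HasZeros O (W.vert (W.xAt T)) {T, T'}) :
    -W.yAt T' - W.a₁ * W.xAt T' - W.a₃ = a * W.xAt T' + b := by
  obtain ⟨s, hs, hs3⟩ := W.exists_zeros_line a b
  obtain ⟨t, ht, -⟩ := W.exists_zeros_conjLine a b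
  rw [← W.mem_zeros_conjLine ht hT']
  set r := W.xAt T with hr
  set e₁ := a ^ 2 + W.a₁ * a - W.a₂ with he₁
  set e₂ := 2 * a * b + W.a₁ * b + W.a₃ * a - W.a₄ with he₂
  -- the cubic of which `x` is the variable has the root `r`
  have hroot : r ^ 3 - e₁ * r ^ 2 - e₂ * r - (b ^ 2 + W.a₃ * b - W.a₆) = 0 := by
    have h1 := W.equation_at hT
    rw [h, ← hr] at h1
    rw [he₁, he₂]
    linear_combination -h1
  have hprod : W.vert r * -(W.x ^ 2 + algebraMap k F (r - e₁) * W.x +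
      algebraMap k F (r ^ 2 - e₁ * r - e₂)) = W.line a b * W.conjLine a b := by
    rw [line_mul_conjLine, vert, ← he₁, ← he₂]
    have := congr(algebraMap k F $hroot)
    simp only [map_sub, map_add, map_mul, map_pow, map_zero] at this ⊢
    linear_combination this
  have hle : ({T, T'} : Multiset X) ≤ s + t := hneg.le_of_mul_eq (hs.mul ht) (fun S hS =>
    ((((W.ge_x S hS).pow 2).of_le (by simp)).add ((W.ge_x S hS).const_mul _)).add
      (Ge.const _) |>.neg) hprod
  by_contra hmem
  refine W.not_le_zeros_line hs hs3 hneg.pt_add_pt ?_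
  have hTs := (W.mem_zeros_line hs hT).2 h
  rw [Multiset.le_iff_count] at hle ⊢
  intro S
  have h1 := hle S
  rw [Multiset.count_add] at h1
  by_cases hST' : S = T'
  · subst hST'
    rwa [Multiset.count_eq_zero.2 hmem, add_zero] at h1
  · have h2 : Multiset.count S {T, T'} = Multiset.count S {T} := by
      rw [Multiset.insert_eq_cons, Multiset.count_cons, Multiset.count_singleton,
        Multiset.count_singleton, if_neg hST', zero_add]
    rw [h2]
    exact (Multiset.le_iff_count.1 (Multiset.singleton_le.2 hTs)) S

/-- The `y`-coordinate of the negative of a point. -/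
lemma yAt_neg (hT : T ≠ O) {T' : X} (hT' : T' ≠ O) (hx : W.xAt T' = W.xAt T)
    (hneg : P.HasZeros O (W.vert (W.xAt T)) {T, T'}) :
    W.yAt T' = -W.yAt T - W.a₁ * W.xAt T - W.a₃ := by
  have := W.neg_mem_conjLine (a := 0) (b := W.yAt T) hT (by ring) hT' hneg
  rw [hx] at this
  linear_combination -this

/-- A point is determined by its coordinates. -/
lemma eq_of_xAt_eq (hT : T ≠ O) (hS : S ≠ O) (hx : W.xAt S = W.xAt T) (hy : W.yAt S = W.yAt T) :
    S = T := by
  obtain ⟨T', hT', hx', h, -⟩ := W.exists_neg hT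
  have := (W.mem_zeros_vert h hS).2 hx
  rcases (by simpa using this : S = T ∨ S = T') with rfl | rfl
  · rfl
  -- otherwise the horizontal line through both meets the curve in `O`
  by_contra hne
  obtain ⟨s, hs, hs3⟩ := W.exists_zeros_line 0 (W.yAt T)
  refine W.not_le_zeros_line hs hs3 h.pt_add_pt ?_
  rw [Multiset.insert_eq_cons, Multiset.cons_le_of_notMem (by simpa using Ne.symm hne),
    Multiset.singleton_le, W.mem_zeros_line hs hT, W.mem_zeros_line hs hS]
  simp [hy]

/-- The chord construction: the third point on the line through two points with distinct
`x`-coordinates. -/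
lemma exists_chord (hT : T ≠ O) (hS : S ≠ O) (hx : W.xAt T ≠ W.xAt S) {a : k}
    (ha : a = (W.yAt T - W.yAt S) / (W.xAt T - W.xAt S)) :
    ∃ R, R ≠ O ∧ P.pt O R = -(P.pt O T + P.pt O S) ∧
      W.xAt R = a ^ 2 + W.a₁ * a - W.a₂ - W.xAt T - W.xAt S ∧
      W.yAt R = a * (W.xAt R - W.xAt T) + W.yAt T := by
  set b := W.yAt T - a * W.xAt T with hb
  have hx0 : W.xAt T - W.xAt S ≠ 0 := sub_ne_zero.2 hx
  have hlT : W.yAt T = a * W.xAt T + b := by rw [hb]; ring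
  have hlS : W.yAt S = a * W.xAt S + b := by
    have h1 : a * (W.xAt T - W.xAt S) = W.yAt T - W.yAt S := by
      rw [ha, div_mul_cancel₀ _ hx0]
    rw [hb]; linear_combination h1
  obtain ⟨s, hs, hs3⟩ := W.exists_zeros_line a b
  obtain ⟨t, ht, -⟩ := W.exists_zeros_conjLine a b
  have hTS : T ≠ S := by rintro rfl; exact hx rfl
  have hle : ({T, S} : Multiset X) ≤ s := by
    rw [Multiset.insert_eq_cons, Multiset.cons_le_of_notMem (by simpa using hTS),
      Multiset.singleton_le, W.mem_zeros_line hs hT, W.mem_zeros_line hs hS]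
    exact ⟨hlT, hlS⟩
  obtain ⟨u, rfl⟩ := Multiset.le_iff_exists_add.1 hle
  simp only [Multiset.card_add, Multiset.card_pair] at hs3
  obtain ⟨R, rfl⟩ := Multiset.card_eq_one.1 (show u.card = 1 by omega)
  have hR : R ≠ O := hs.ne_base (by simp)
  have hsum : P.pt O T + P.pt O S + P.pt O R = 0 := hs.pt_add_pt_add_pt
  have hlR := (W.mem_zeros_line hs hR).1 (by simp)
  refine ⟨R, hR, eq_neg_of_add_eq_zero_right hsum, ?_, by rw [hlR, hlT]; ring⟩
  set e₁ := a ^ 2 + W.a₁ * a - W.a₂ with he₁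
  set e₂ := 2 * a * b + W.a₁ * b + W.a₃ * a - W.a₄ with he₂
  set p := W.xAt T with hp
  set q := W.xAt S with hq
  -- the cubic in `x` splits with roots `p`, `q` and `r`
  have hp' : p ^ 3 - e₁ * p ^ 2 - e₂ * p - (b ^ 2 + W.a₃ * b - W.a₆) = 0 := by
    have h1 := W.equation_at hT
    rw [hlT, ← hp] at h1
    rw [he₁, he₂]; linear_combination -h1
  have hq' : q ^ 3 - e₁ * q ^ 2 - e₂ * q - (b ^ 2 + W.a₃ * b - W.a₆) = 0 := by
    have h1 := W.equation_at hS
    rw [hlS, ← hq] at h1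
    rw [he₁, he₂]; linear_combination -h1
  have he₂' : e₂ = p ^ 2 + p * q + q ^ 2 - e₁ * (p + q) := by
    refine mul_left_cancel₀ hx0 ?_
    linear_combination hq' - hp'
  set r := e₁ - p - q with hr
  have hprod : -(W.vert p * W.vert q * W.vert r) = W.line a b * W.conjLine a b := by
    rw [line_mul_conjLine, ← he₁, ← he₂]
    have h1 : b ^ 2 + W.a₃ * b - W.a₆ = p * q * r := by
      rw [hr]; linear_combination -hp' - p * he₂'
    have h2 : e₁ = p + q + r := by rw [hr]; ring
    rw [h1, he₂', h2]
    simp only [vert, map_sub, map_add, map_mul, map_pow]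
    ring
  obtain ⟨T', hT', -, hzT, hnT⟩ := W.exists_neg hT
  obtain ⟨S', hS', -, hzS, hnS⟩ := W.exists_neg hS
  obtain ⟨A, B, hz⟩ := W.exists_zeros_vert r
  have hz' := ((hzT.mul hzS).mul hz).neg
  rw [hprod] at hz'
  have heq := hz'.unique (hs.mul ht)
  have hmem : R ∈ ({T', S', A, B} : Multiset X) := by
    have h1 : ({T, S} : Multiset X) + ({T', S', A, B} : Multiset X) =
        ({T, S} : Multiset X) + ({R} + t) := by
      rw [← add_assoc, ← heq]
      simp only [Multiset.insert_eq_cons, ← Multiset.singleton_add]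
      abel
    rw [add_left_cancel h1]
    simp
  simp only [Multiset.insert_eq_cons, Multiset.mem_cons, Multiset.mem_singleton] at hmem
  rcases hmem with rfl | rfl | rfl | rfl
  · rw [hnT] at hsum
    exact absurd (by simpa [add_comm, add_assoc] using hsum) (pt_ne_zero (P := P) hS)
  · rw [hnS] at hsum
    exact absurd (by simpa [add_assoc] using hsum) (pt_ne_zero (P := P) hT)
  · exact (W.mem_zeros_vert hz hR).1 (by simp)
  · exact (W.mem_zeros_vert hz hR).1 (by simp)

end Zeros

end Weierstrass

end FunctionField

namespace FunctionField

variable {k F X : Type*} [Field k] [Field F] [Algebra k F]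

namespace Weierstrass

variable {P : FunctionField k F X} {O : X} (W : P.Weierstrass O) {T S R : X}

/-! ### Points of order two and three -/

section Torsion

lemma eq_zero_of_linear {c d e : k}
    (h : algebraMap k F c * W.y + algebraMap k F d * W.x + algebraMap k F e = 0) :
    c = 0 ∧ d = 0 ∧ e = 0 := by
  have hc : c = 0 := by
    by_contra hc
    refine (W.ord_line (-d / c) (-e / c)).1 ?_
    have hc' : algebraMap k F c ≠ 0 := by simpa using hc
    simp only [line, map_div₀, map_neg]
    field_simp
    linear_combination h
  subst hc
  have hd : d = 0 := by
    by_contra hd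
    refine (W.ord_vert (-e / d)).1 ?_
    have hd' : algebraMap k F d ≠ 0 := by simpa using hd
    simp only [vert, map_div₀, map_neg]
    field_simp
    rw [map_zero] at h
    linear_combination h
  subst hd
  exact ⟨rfl, rfl, by simpa using h⟩

/-- The function whose zeros are the points of order two. -/
lemma val_two_y (hT : T ≠ O) : P.Val T (algebraMap k F 2 * W.y + algebraMap k F W.a₁ * W.x +
    algebraMap k F W.a₃) (2 * W.yAt T + W.a₁ * W.xAt T + W.a₃) :=
  (((Val.const 2).mul (W.val_y hT)).add ((Val.const _).mul (W.val_x hT))).add (Val.const _)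

lemma two_pt_eq_zero_iff (hT : T ≠ O) :
    P.pt O T + P.pt O T = 0 ↔ 2 * W.yAt T + W.a₁ * W.xAt T + W.a₃ = 0 := by
  classical
  obtain ⟨T', hT', hx, hz, hn⟩ := W.exists_neg hT
  have hy := W.yAt_neg hT hT' hx hz
  constructor
  · intro h
    have : T' = T := pt_injective (hn.trans (neg_eq_of_add_eq_zero_left h))
    rw [this] at hy
    linear_combination hy
  · intro h
    have : T' = T := W.eq_of_xAt_eq hT hT' hx (by rw [hy]; linear_combination -h)
    rw [this] at hn
    nth_rw 1 [hn]
    simp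

/-- Without points of order two, the characteristic is two and the curve is supersingular. -/
lemma supersingular_of_two_torsion_eq_zero (h : ∀ g : P.Pic O, g + g = 0 → g = 0) :
    (2 : k) = 0 ∧ W.a₁ = 0 ∧ W.a₃ ≠ 0 := by
  classical
  set f := algebraMap k F 2 * W.y + algebraMap k F W.a₁ * W.x + algebraMap k F W.a₃ with hf
  have hval (T : X) (hT : T ≠ O) : ¬ P.Ge 1 T f := fun h1 => by
    have h2 := (W.val_two_y hT).unique (val_zero_iff.2 h1)
    exact pt_ne_zero hT (h _ ((W.two_pt_eq_zero_iff hT).2 h2))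
  obtain ⟨T, hT, -⟩ := W.exists_xAt_eq 0
  have hf0 : f ≠ 0 := fun h0 => hval T hT (by rw [h0]; exact Ge.zero)
  obtain ⟨s, hs⟩ := exists_hasZeros hf0 fun T hT => (W.val_two_y hT).ge
  have hs0 : s = 0 := Multiset.eq_zero_of_forall_notMem fun T hTs =>
    hval T (hs.ne_base hTs) ((hs.mem_iff (hs.ne_base hTs)).1 hTs)
  obtain ⟨c, hc⟩ := P.eq_const O (f := f) fun S _ => by
    by_cases hS : S = O
    · rw [hS, hs.ord_base, hs0]; simp
    · rw [hs.ord_eq S hS]; positivity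
  have h1 := W.eq_zero_of_linear (c := 2) (d := W.a₁) (e := W.a₃ - c) (by
    rw [map_sub, ← hc, hf]; ring)
  refine ⟨h1.1, h1.2.1, fun h3 => hf0 ?_⟩
  rw [hf, h1.1, h1.2.1, h3]; simp

/-- The tangent construction on a supersingular curve in characteristic two. -/
lemma exists_tangent (h2 : (2 : k) = 0) (ha₁ : W.a₁ = 0) (ha₃ : W.a₃ ≠ 0) (hT : T ≠ O) :
    ∃ R, R ≠ O ∧ P.pt O R = -(P.pt O T + P.pt O T) ∧
      W.xAt R = ((W.xAt T ^ 2 + W.a₄) / W.a₃) ^ 2 - W.a₂ := by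
  classical
  set p := W.xAt T with hp
  obtain ⟨a, ha⟩ : ∃ a, a = (p ^ 2 + W.a₄) / W.a₃ := ⟨_, rfl⟩
  rw [← ha]
  have ha' : W.a₃ * a = p ^ 2 + W.a₄ := by rw [ha, mul_div_cancel₀ _ ha₃]
  set b := W.yAt T - a * p with hb
  have hlT : W.yAt T = a * p + b := by rw [hb]; ring
  obtain ⟨s, hs, hs3⟩ := W.exists_zeros_line a b
  obtain ⟨t, ht, -⟩ := W.exists_zeros_conjLine a b
  have hTt : T ∉ t := fun h => ha₃ (by
    have h1 := (W.mem_zeros_conjLine ht hT).1 h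
    rw [ha₁, ← hp, ← hlT] at h1
    linear_combination -h1 - W.yAt T * h2)
  set r := a ^ 2 - W.a₂ with hr
  have hprod : -(W.vert p * W.vert p * W.vert r) = W.line a b * W.conjLine a b := by
    rw [line_mul_conjLine]
    have e0 := W.equation_at hT
    rw [hlT, ← hp] at e0
    have e1 : a ^ 2 + W.a₁ * a - W.a₂ = p + p + r := by
      rw [hr, ha₁]; linear_combination -p * h2
    have e2 : 2 * a * b + W.a₁ * b + W.a₃ * a - W.a₄ = -(p ^ 2 + 2 * p * r) := by
      rw [ha₁, ha']; linear_combination (a * b + p ^ 2 + p * r) * h2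
    have e3 : b ^ 2 + W.a₃ * b - W.a₆ = p * p * r := by
      rw [ha₁] at e0
      rw [hr]
      linear_combination e0 - p * ha' - a * b * p * h2 - p ^ 2 * a ^ 2 * h2 + p ^ 2 * W.a₂ * h2
    rw [e1, e2, e3]
    simp only [vert, map_add, map_mul, map_pow, map_neg, map_ofNat]
    ring
  obtain ⟨T', hT', -, hzT, hnT⟩ := W.exists_neg hT
  obtain ⟨A, B, hz⟩ := W.exists_zeros_vert r
  have hz' := ((hzT.mul hzT).mul hz).neg
  rw [hprod] at hz'
  have heq := hz'.unique (hs.mul ht)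
  have hle : ({T, T} : Multiset X) ≤ s := by
    rw [Multiset.le_iff_count]
    intro S
    by_cases hS : S = T
    · subst hS
      have := congr(Multiset.count S $heq)
      simp only [Multiset.count_add, Multiset.insert_eq_cons, Multiset.count_cons_self,
        Multiset.count_eq_zero.2 hTt, add_zero] at this
      simp only [Multiset.insert_eq_cons, Multiset.count_cons_self, Multiset.count_singleton_self]
      omega
    · simp [Multiset.insert_eq_cons, hS]
  obtain ⟨u, rfl⟩ := Multiset.le_iff_exists_add.1 hle
  simp only [Multiset.card_add, Multiset.card_pair] at hs3
  obtain ⟨R, rfl⟩ := Multiset.card_eq_one.1 (show u.card = 1 by omega)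
  have hR : R ≠ O := hs.ne_base (by simp)
  have hsum : P.pt O T + P.pt O T + P.pt O R = 0 := hs.pt_add_pt_add_pt
  refine ⟨R, hR, eq_neg_of_add_eq_zero_right hsum, ?_⟩
  have hmem : R ∈ ({T', T', A, B} : Multiset X) := by
    have h1 : ({T, T} : Multiset X) + ({T', T', A, B} : Multiset X) =
        ({T, T} : Multiset X) + ({R} + t) := by
      rw [← add_assoc, ← heq]
      simp only [Multiset.insert_eq_cons, ← Multiset.singleton_add]
      abel
    rw [add_left_cancel h1]
    simp
  simp only [Multiset.insert_eq_cons, Multiset.mem_cons, Multiset.mem_singleton] at hmem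
  have hRT' : R ≠ T' := by
    rintro rfl
    rw [hnT] at hsum
    exact pt_ne_zero (P := P) hT (by simpa [add_assoc] using hsum)
  rcases hmem with h | h | rfl | rfl
  · exact absurd h hRT'
  · exact absurd h hRT'
  · exact (W.mem_zeros_vert hz hR).1 (by simp)
  · exact (W.mem_zeros_vert hz hR).1 (by simp)

variable [IsAlgClosed k]

lemma infinite_points (P : FunctionField k F X) (O : X) : Infinite X := by
  classical
  obtain ⟨W⟩ := P.exists_weierstrass O
  exact Infinite.of_surjective W.xAt fun c => (W.exists_xAt_eq c).imp fun _ h => h.2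

/-- Not every point has order two. Otherwise the characteristic would be two and the equation
would be `y ^ 2 = f(x)`; such a curve has a singular point `(a, b)`, and `(y - b) / (x - a)` would
be a function with a single simple pole. -/
theorem exists_add_self_ne_zero : ∃ g : P.Pic O, g + g ≠ 0 := by
  obtain ⟨W⟩ := P.exists_weierstrass O
  by_contra! hall
  have := infinite_points P O
  have h0 : algebraMap k F 2 * W.y + algebraMap k F W.a₁ * W.x + algebraMap k F W.a₃ = 0 := by
    by_contra hne
    obtain ⟨T, h1, h2⟩ := ((eventually_ev_ne_zero (P := P) hne).and
      (Set.finite_singleton O).eventually_cofinite_notMem).exists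
    have h3 := W.val_two_y (T := T) (by simpa using h2)
    rw [(W.two_pt_eq_zero_iff (by simpa using h2)).1 (hall _)] at h3
    exact h1 h3.ev_eq
  obtain ⟨h2, ha₁, ha₃⟩ := W.eq_zero_of_linear h0
  obtain ⟨a, ha⟩ := IsAlgClosed.exists_pow_nat_eq W.a₄ (n := 2) two_pos
  obtain ⟨b, hb⟩ := IsAlgClosed.exists_pow_nat_eq (a ^ 3 + W.a₂ * a ^ 2 + W.a₄ * a + W.a₆)
    (n := 2) two_pos
  have hv := W.ord_vert a
  have hl := W.ord_line 0 b
  have hsq : (W.line 0 b / W.vert a) ^ 2 = W.x + algebraMap k F W.a₂ := by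
    rw [div_pow, div_eq_iff (pow_ne_zero 2 hv.1)]
    have e1 := W.equation
    have e2 := congr(algebraMap k F $h2)
    have e3 := congr(algebraMap k F $ha)
    have e4 := congr(algebraMap k F $hb)
    simp only [ha₁, ha₃, map_zero, map_add, map_mul, map_pow, map_ofNat] at e1 e2 e3 e4
    simp only [line, vert, map_zero]
    generalize algebraMap k F a = a at *
    generalize algebraMap k F b = b at *
    generalize algebraMap k F W.a₂ = a₂ at *
    generalize algebraMap k F W.a₄ = a₄ at *
    generalize algebraMap k F W.a₆ = a₆ at *
    linear_combination e1 - e4 + (b ^ 2 - W.y * b + a * W.x ^ 2 + a₂ * a * W.x - a₂ * a ^ 2 -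
      a ^ 3) * e2 - (W.x - a) * e3
  have hz0 : W.line 0 b / W.vert a ≠ 0 := div_ne_zero hl.1 hv.1
  have hord : P.ord (W.line 0 b / W.vert a) O = -1 := by
    rw [div_eq_mul_inv, P.ord_mul hl.1 (inv_ne_zero hv.1), P.ord_inv hv.1, hl.2, hv.2]
    norm_num
  have := P.ge_of_ge_neg_one O (f := W.line 0 b / W.vert a) (fun S hS _ => by
    have h1 : P.Ge 0 S ((W.line 0 b / W.vert a) ^ 2) := by
      rw [hsq]; exact (W.ge_x S hS).add (Ge.const _)
    have := h1 (pow_ne_zero 2 hz0)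
    rw [P.ord_pow hz0] at this
    push_cast at this
    omega) (fun _ => by rw [hord]) hz0
  omega

/-- Without points of order two, there are points of order three, and not every point is
annihilated by three. -/
theorem three_torsion_of_two_torsion_eq_zero (h : ∀ g : P.Pic O, g + g = 0 → g = 0) :
    (∃ g : P.Pic O, g ≠ 0 ∧ 3 • g = 0) ∧ ∃ g : P.Pic O, 3 • g ≠ 0 := by
  classical
  obtain ⟨W⟩ := P.exists_weierstrass O
  obtain ⟨h2, ha₁, ha₃⟩ := W.supersingular_of_two_torsion_eq_zero h
  -- the equation `x(2T) = x(T) + c` is an equation of degree four for `u = x(T)`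
  have key (c : k) : ∃ u : k, ((u ^ 2 + W.a₄) / W.a₃) ^ 2 - W.a₂ - u = c := by
    obtain ⟨u, hu⟩ := IsAlgClosed.exists_root ((Polynomial.X ^ 2 + Polynomial.C W.a₄) ^ 2 +
      (Polynomial.C (W.a₃ ^ 2 * -1) * Polynomial.X +
        Polynomial.C (W.a₃ ^ 2 * (-W.a₂ - c)))) (by
      have h1 : ((Polynomial.X ^ 2 + Polynomial.C W.a₄) ^ 2 : Polynomial k).degree = 4 := by
        rw [Polynomial.degree_pow, Polynomial.degree_X_pow_add_C two_pos]; rfl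
      have h2 := Polynomial.degree_linear_le (a := W.a₃ ^ 2 * -1) (b := W.a₃ ^ 2 * (-W.a₂ - c))
      rw [Polynomial.degree_add_eq_left_of_degree_lt (h2.trans_lt (by rw [h1]; decide)), h1]
      decide)
    refine ⟨u, ?_⟩
    simp only [Polynomial.IsRoot.def, Polynomial.eval_add, Polynomial.eval_pow,
      Polynomial.eval_X, Polynomial.eval_C, Polynomial.eval_mul] at hu
    field_simp
    linear_combination hu
  have hpt (c : k) : ∃ T R, T ≠ O ∧ R ≠ O ∧ P.pt O R = -(P.pt O T + P.pt O T) ∧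
      W.xAt R = W.xAt T + c := by
    obtain ⟨u, hu⟩ := key c
    obtain ⟨T, hT, rfl⟩ := W.exists_xAt_eq u
    obtain ⟨R, hR, hs, hx⟩ := W.exists_tangent h2 ha₁ ha₃ hT
    exact ⟨T, R, hT, hR, hs, by rw [hx]; linear_combination hu⟩
  constructor
  · obtain ⟨T, R, hT, hR, hs, hx⟩ := hpt 0
    refine ⟨P.pt O T, pt_ne_zero hT, ?_⟩
    rcases W.pt_eq_or_eq_neg hT hR (by rw [hx, add_zero]) with h1 | h1
    · rw [h1] at hs
      rw [show 3 • P.pt O T = P.pt O T + (P.pt O T + P.pt O T) by abel]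
      exact eq_neg_iff_add_eq_zero.1 hs
    · rw [h1, neg_inj, left_eq_add] at hs
      exact absurd hs (pt_ne_zero hT)
  · obtain ⟨T, R, hT, hR, hs, hx⟩ := hpt 1
    refine ⟨P.pt O T, fun h3 => ?_⟩
    have : P.pt O R = P.pt O T := by
      rw [hs, neg_eq_iff_add_eq_zero, ← h3]; abel
    rw [pt_injective this] at hx
    simp at hx

end Torsion

end Weierstrass

end FunctionField

namespace FunctionField

variable {k F X : Type*} [Field k] [Field F] [Algebra k F]

/-! ### Families of points given by rational functions -/

namespace Weierstrass

variable {P : FunctionField k F X} {O : X} (W : P.Weierstrass O) {T S R : X}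

open Filter

/-- The map `φ` to the group of points is given, at all but finitely many points, by the pair of
rational functions `(r, s)`: the point `φ T` has coordinates `r(T)` and `s(T)`. -/
def IsRational (φ : X → P.Pic O) (r s : F) : Prop :=
  ∀ᶠ T in cofinite, ∃ R, R ≠ O ∧ φ T = P.pt O R ∧ P.Val T r (W.xAt R) ∧ P.Val T s (W.yAt R)

variable {W} {φ ψ : X → P.Pic O} {r s r' s' : F}

lemma isRational_pt : W.IsRational (P.pt O) W.x W.y := by
  filter_upwards [(Set.finite_singleton O).eventually_cofinite_notMem] with T hT
  exact ⟨T, hT, rfl, W.val_x hT, W.val_y hT⟩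

lemma isRational_const (hR : R ≠ O) : W.IsRational (fun _ => P.pt O R)
    (algebraMap k F (W.xAt R)) (algebraMap k F (W.yAt R)) :=
  Eventually.of_forall fun _ => ⟨R, hR, rfl, Val.const _, Val.const _⟩

namespace IsRational

lemma neg (h : W.IsRational φ r s) : W.IsRational (fun T => -φ T) r
    (-s - algebraMap k F W.a₁ * r - algebraMap k F W.a₃) := by
  classical
  filter_upwards [h] with T ⟨R, hR, hφ, hr, hs⟩
  obtain ⟨R', hR', hx, hz, hn⟩ := W.exists_neg hR
  refine ⟨R', hR', by rw [hn, hφ], by rwa [hx], ?_⟩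
  rw [W.yAt_neg hR hR' hx hz]
  exact (hs.neg.sub ((Val.const _).mul hr)).sub (Val.const _)

lemma neg_add (h : W.IsRational φ r s) (h' : W.IsRational ψ r' s') (hne : r ≠ r') :
    ∃ r'' s'', W.IsRational (fun T => -(φ T + ψ T)) r'' s'' := by
  classical
  set a := (s - s') / (r - r') with ha
  set r'' := a ^ 2 + algebraMap k F W.a₁ * a - algebraMap k F W.a₂ - r - r' with hr''
  refine ⟨r'', a * (r'' - r) + s, ?_⟩
  filter_upwards [h, h', eventually_ev_ne_zero (P := P) (sub_ne_zero.2 hne)]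
    with T ⟨R, hR, hφ, hr, hs⟩ ⟨R', hR', hψ, hr', hs'⟩ h0
  rw [(hr.sub hr').ev_eq] at h0
  have hav : P.Val T a _ := (hs.sub hs').div (hr.sub hr') h0
  obtain ⟨R'', hR'', hadd, hx, hy⟩ := W.exists_chord hR hR' (sub_ne_zero.1 h0) rfl
  have hxv : P.Val T r'' (W.xAt R'') := by
    rw [hx]
    exact ((((hav.pow 2).add ((Val.const _).mul hav)).sub (Val.const _)).sub hr).sub hr'
  refine ⟨R'', hR'', by rw [hadd, hφ, hψ], hxv, ?_⟩
  rw [hy]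
  exact (hav.mul (hxv.sub hr)).add hs

lemma add (h : W.IsRational φ r s) (h' : W.IsRational ψ r' s') (hne : r ≠ r') :
    ∃ r'' s'', W.IsRational (fun T => φ T + ψ T) r'' s'' := by
  obtain ⟨r'', s'', h''⟩ := h.neg_add h' hne
  exact ⟨_, _, by simpa using h''.neg⟩

lemma eq_or_eq_neg (h : W.IsRational φ r s) (h' : W.IsRational ψ r s') :
    ∀ᶠ T in cofinite, φ T = ψ T ∨ φ T = -ψ T := by
  classical
  filter_upwards [h, h'] with T ⟨R, hR, hφ, hr, _⟩ ⟨R', hR', hψ, hr', _⟩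
  rw [hφ, hψ]
  exact W.pt_eq_or_eq_neg hR' hR (hr.unique hr')

end IsRational

/-- A nonconstant function has a zero, as otherwise its inverse would have no pole. -/
lemma exists_zero_of_nonconstant {f : F} (O : X) (hf : ∀ c : k, f ≠ algebraMap k F c) :
    ∃ T, P.Ge 1 T f := by
  by_contra! h
  have hf0 : f ≠ 0 := by simpa using hf 0
  obtain ⟨c, hc⟩ := P.eq_const O (f := f⁻¹) fun T _ => by
    rw [P.ord_inv hf0]
    have : ¬ 1 ≤ P.ord f T := fun h1 => h T fun _ => h1
    omega
  exact hf c⁻¹ (by rw [map_inv₀, ← hc, inv_inv])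

/-- If `r` is not constant, then `φ` takes almost all values up to sign. -/
lemma IsRational.eventually_mem (h : W.IsRational φ r s) (hr : ∀ c : k, r ≠ algebraMap k F c) :
    ∀ᶠ Q in cofinite, ∃ T, φ T = P.pt O Q ∨ φ T = -P.pt O Q := by
  classical
  have hzero (Q : X) : ∃ T, P.Val T r (W.xAt Q) :=
    exists_zero_of_nonconstant O fun c hc => hr (c + W.xAt Q) (by rw [map_add, ← hc]; ring)
  choose τ hτ using hzero
  have hfib (c : k) : {Q | Q ≠ O ∧ W.xAt Q = c}.Finite := by
    obtain ⟨A, B, hz⟩ := W.exists_zeros_vert c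
    refine (Set.toFinite {A, B}).subset fun Q hQ => ?_
    simpa using (W.mem_zeros_vert hz hQ.1).2 hQ.2
  -- only finitely many `Q` have a preimage among the points where `φ` is not given by `(r, s)`
  have hbad := (show Set.Finite _ from h).biUnion fun T _ => hfib (P.ev T r)
  filter_upwards [hbad.eventually_cofinite_notMem,
    (Set.finite_singleton O).eventually_cofinite_notMem] with Q hQ hQO
  have hgood : ∃ R, R ≠ O ∧ φ (τ Q) = P.pt O R ∧ P.Val (τ Q) r (W.xAt R) ∧
      P.Val (τ Q) s (W.yAt R) := by
    by_contra hcon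
    exact hQ (Set.mem_biUnion (x := τ Q) hcon ⟨hQO, (hτ Q).ev_eq.symm⟩)
  obtain ⟨R, hR, hφ, hr, -⟩ := hgood
  refine ⟨τ Q, ?_⟩
  rw [hφ]
  exact W.pt_eq_or_eq_neg hQO hR (hr.unique (hτ Q))

end Weierstrass

/-! ### Divisibility -/

section Divisible

open Filter

variable (P : FunctionField k F X) (O : X)

lemma eventually_pt {p : P.Pic O → Prop} :
    (∀ᶠ T in cofinite, p (P.pt O T)) ↔ ∀ᶠ g in cofinite, p g := by
  constructor
  · intro h
    filter_upwards [(P.ptEquiv O).symm.injective.tendsto_cofinite.eventually h] with g hg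
    rwa [show P.pt O ((P.ptEquiv O).symm g) = g from (P.ptEquiv O).apply_symm_apply g] at hg
  · exact fun h => pt_injective.tendsto_cofinite.eventually h

variable {P O}

lemma eventually_add {G : Type*} [AddCommGroup G] {p : G → Prop} (h : ∀ᶠ g in cofinite, p g)
    (a : G) : ∀ᶠ g in cofinite, p (g + a) :=
  (add_left_injective a).tendsto_cofinite.eventually h

lemma eventually_neg_add {G : Type*} [AddCommGroup G] {p : G → Prop} (h : ∀ᶠ g in cofinite, p g)
    (a : G) : ∀ᶠ g in cofinite, p (a - g) :=
  (sub_right_injective (b := a)).tendsto_cofinite.eventually h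

variable [IsAlgClosed k]

variable (P O) in
lemma infinite_pic : Infinite (P.Pic O) := by
  have := Weierstrass.infinite_points P O
  exact Infinite.of_injective _ (pt_injective (P := P) (O := O))

/-- If multiplication by `n` is given by rational functions, then it is surjective. -/
lemma surjective_nsmul_of_isRational {W : P.Weierstrass O} {n : ℕ} {r s : F}
    (h : W.IsRational (fun T => n • P.pt O T) r s) : ∀ g : P.Pic O, ∃ g', n • g' = g := by
  classical
  have := P.infinite_pic O
  have := Weierstrass.infinite_points P O
  by_cases hr : ∃ c : k, r = algebraMap k F c
  · -- multiplication by `n` would take the same nonzero value, up to sign, almost everywhere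
    exfalso
    obtain ⟨c, rfl⟩ := hr
    obtain ⟨_, R₀, hR₀, -, hv₀, -⟩ := h.exists
    have h0 := pt_ne_zero (P := P) hR₀
    have hval : ∀ᶠ g : P.Pic O in cofinite, n • g = P.pt O R₀ ∨ n • g = -P.pt O R₀ := by
      rw [← eventually_pt]
      filter_upwards [h] with T ⟨R, hR, hT, hv, _⟩
      rw [hT]
      exact W.pt_eq_or_eq_neg hR₀ hR ((hv.unique (Val.const c)).trans
        ((hv₀.unique (Val.const c)).symm))
    -- choose `a` and `b` so that this holds at `a`, `b`, `b + a` and `a - b`; one of the last two is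
    -- sent to zero
    obtain ⟨a, ha⟩ := hval.exists
    obtain ⟨b, hb, h1, h2⟩ := (hval.and ((eventually_add hval a).and
      (eventually_neg_add hval a))).exists
    rw [nsmul_add] at h1
    rw [nsmul_sub] at h2
    rcases ha with ha | ha <;> rcases hb with hb | hb <;> rw [ha, hb] at h1 h2 <;>
      simp [eq_comm] at h1 h2 <;> first | exact h0 h1.symm | exact h0 h2.symm
  · push Not at hr
    have h1 : ∀ᶠ g : P.Pic O in cofinite, ∃ g', n • g' = g := by
      rw [← eventually_pt]
      filter_upwards [h.eventually_mem hr] with Q ⟨T, hT⟩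
      rcases hT with hT | hT
      · exact ⟨_, hT⟩
      · exact ⟨-P.pt O T, by rw [neg_nsmul, hT, neg_neg]⟩
    intro g
    obtain ⟨a, ⟨a', ha⟩, b', hb⟩ := (h1.and (eventually_neg_add h1 g)).exists
    exact ⟨a' + b', by rw [nsmul_add, ha, hb]; abel⟩

/-- Multiplication by `n`, followed by a translation, is given by rational functions, unless
multiplication by a positive integer `m ≤ n` is zero. -/
lemma exists_isRational (W : P.Weierstrass O) (N : ℕ)
    (hN : ∀ m, 1 ≤ m → m ≤ N → ∃ g : P.Pic O, m • g ≠ 0) (n : ℕ) (hn : 1 ≤ n) (hnN : n ≤ N) :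
    ∀ a : P.Pic O, ∃ r s, W.IsRational (fun T => n • P.pt O T + a) r s := by
  classical
  have := P.infinite_pic O
  have h1 (a : P.Pic O) : ∃ r s, W.IsRational (fun T => P.pt O T + a) r s := by
    by_cases ha : a = 0
    · subst ha
      exact ⟨W.x, W.y, by simpa using Weierstrass.isRational_pt⟩
    · obtain ⟨R, rfl⟩ := pt_surjective (P := P) (O := O) a
      refine Weierstrass.isRational_pt.add (Weierstrass.isRational_const (R := R) ?_) ?_
      · rintro rfl; exact ha pt_self
      · intro h
        have := (W.ord_vert (W.xAt R)).1
        rw [Weierstrass.vert, h, sub_self] at this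
        exact this rfl
  induction n, hn using Nat.le_induction with
  | base => simpa using h1
  | succ n hn ih =>
    intro a
    by_contra hcon
    obtain ⟨b, hb⟩ := Weierstrass.exists_add_self_ne_zero (P := P) (O := O)
    have key (c : P.Pic O) : ∀ᶠ g : P.Pic O in cofinite,
        (n + 1) • g = -a ∨ n • g - g = a - c - c := by
      obtain ⟨r, s, h⟩ := ih (by omega) c
      obtain ⟨r', s', h'⟩ := h1 (a - c)
      -- write the sum as `(n T + c) + (T + (a - c))`; the two summands have the same `x`-coordinate,
      -- since otherwise the chord construction would apply
      have hrr : r = r' := by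
        by_contra hne
        obtain ⟨r'', s'', h''⟩ := h.add h' hne
        refine hcon ⟨r'', s'', ?_⟩
        convert h'' using 2 with T
        rw [succ_nsmul]; abel
      subst hrr
      rw [← eventually_pt]
      filter_upwards [h.eq_or_eq_neg h'] with T hT
      rcases hT with hT | hT
      · right
        rw [sub_eq_iff_eq_add, ← sub_eq_zero] at *
        rw [← hT]; abel
      · left
        rw [← sub_eq_zero] at *
        rw [← hT, succ_nsmul]; abel
    -- comparing `c = 0` and `c = b` leaves only the first alternative
    have hconst : ∀ᶠ g : P.Pic O in cofinite, (n + 1) • g = -a := by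
      filter_upwards [key 0, key b] with g h0 h1
      rcases h0 with h0 | h0
      · exact h0
      rcases h1 with h1 | h1
      · exact h1
      · rw [h0] at h1
        refine absurd ?_ hb
        rw [sub_zero, sub_zero, eq_comm, sub_sub, sub_eq_self] at h1
        exact h1
    obtain ⟨g₀, hg₀⟩ := hN (n + 1) (by omega) hnN
    obtain ⟨g, hg, hg'⟩ := (hconst.and (eventually_add hconst g₀)).exists
    rw [nsmul_add, hg, add_eq_left] at hg'
    exact hg₀ hg'

variable (P O) in
/-- The group of points of a curve of genus one over an algebraically closed field is
divisible. -/
theorem exists_nsmul_eq (n : ℕ) (hn : 1 ≤ n) (g : P.Pic O) : ∃ g', n • g' = g := by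
  classical
  have := P.infinite_pic O
  obtain ⟨W⟩ := P.exists_weierstrass O
  have hsurj (n : ℕ) (hn : 1 ≤ n) (h : ∀ m, 1 ≤ m → m ≤ n → ∃ g : P.Pic O, m • g ≠ 0) :
      ∀ g : P.Pic O, ∃ g', n • g' = g := by
    obtain ⟨r, s, h⟩ := exists_isRational W n h n hn le_rfl 0
    exact surjective_nsmul_of_isRational (by simpa using h)
  by_cases h : ∃ N, 1 ≤ N ∧ ∀ g : P.Pic O, N • g = 0
  · -- multiplication by the exponent `N` of the group is zero
    exfalso
    obtain ⟨hN1, hN⟩ := Nat.find_spec h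
    have hmin (m : ℕ) (h1 : 1 ≤ m) (h2 : m < Nat.find h) : ∃ g : P.Pic O, m • g ≠ 0 := by
      have := Nat.find_min h h2
      push Not at this
      exact this h1
    set N := Nat.find h
    have hlt (m : ℕ) (h1 : 1 ≤ m) (h2 : m < N) : ∀ g : P.Pic O, ∃ g', m • g' = g :=
      hsurj m h1 fun m' h1' h2' => hmin m' h1' (by omega)
    obtain ⟨b, hb⟩ := Weierstrass.exists_add_self_ne_zero (P := P) (O := O)
    -- `N` has no proper divisor
    have hdvd (m : ℕ) (h1 : 1 < m) (h2 : m < N) : ¬ m ∣ N := by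
      rintro ⟨q, hq⟩
      have hq1 : 1 ≤ q := by
        rcases Nat.eq_zero_or_pos q with rfl | h
        · omega
        · exact h
      have hq2 : q < N := by rw [hq]; nlinarith
      obtain ⟨c, hc⟩ := hlt m h1.le h2 b
      obtain ⟨e, he⟩ := hlt q hq1 hq2 c
      have := hN e
      rw [hq, mul_smul, he, hc] at this
      exact hb (by rw [this, add_zero])
    have hN1' : N ≠ 1 := fun h1 => hb (by rw [← one_smul ℕ b, ← h1, hN, add_zero])
    have hN2 : N ≠ 2 := fun h1 => hb (by rw [← two_nsmul, ← h1, hN])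
    have hodd : ∃ q, N = 2 * q + 1 := by
      rcases Nat.even_or_odd' N with ⟨q, hq | hq⟩
      · exact absurd ⟨q, hq⟩ (hdvd 2 one_lt_two (by omega))
      · exact ⟨q, hq⟩
    obtain ⟨q, hq⟩ := hodd
    -- as `N` is odd, there is no element of order two
    have htwo (g : P.Pic O) (hg : g + g = 0) : g = 0 := by
      have := hN g
      rwa [hq, succ_nsmul, mul_comm, mul_smul, two_nsmul, hg, smul_zero, zero_add] at this
    obtain ⟨⟨t, ht, ht3⟩, u, hu⟩ := Weierstrass.three_torsion_of_two_torsion_eq_zero htwo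
    have hN3 : N ≠ 3 := fun h1 => hu (by rw [← h1, hN])
    have h3 : ¬ 3 ∣ N := hdvd 3 (by norm_num) (by omega)
    have hcop : Nat.Coprime 3 N := (Nat.Prime.coprime_iff_not_dvd Nat.prime_three).2 h3
    have hord : addOrderOf t ∣ Nat.gcd 3 N :=
      Nat.dvd_gcd (addOrderOf_dvd_of_nsmul_eq_zero ht3) (addOrderOf_dvd_of_nsmul_eq_zero (hN t))
    rw [hcop.gcd_eq_one, Nat.dvd_one, AddMonoid.addOrderOf_eq_one_iff] at hord
    exact ht hord
  · push Not at h
    exact hsurj n hn (fun m h1 _ => h m h1) g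

/-- Every divisor of degree zero is linearly equivalent to an `n`-fold multiple. -/
theorem exists_nsmul_linearEquiv (P : FunctionField k F X) (n : ℕ) (hn : 1 ≤ n) (O : X)
    (D : X →₀ ℤ) (hD : deg D = 0) : ∃ Q : X, ∃ f : F, f ≠ 0 ∧ ∀ T,
      (D - n • (Finsupp.single Q (1 : ℤ) - Finsupp.single O 1) : X →₀ ℤ) T = P.ord f T := by
  obtain ⟨g, hg⟩ := P.exists_nsmul_eq O n hn (QuotientAddGroup.mk D)
  obtain ⟨Q, rfl⟩ := pt_surjective g
  rw [pt, ← QuotientAddGroup.mk_nsmul, eq_comm, ← sub_eq_zero, ← QuotientAddGroup.mk_sub,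
    mk_eq_zero] at hg
  obtain ⟨f, hf, h⟩ := hg
  refine ⟨Q, f, hf, fun T => ?_⟩
  rw [← div_apply P hf, h, map_sub, hD, map_nsmul, deg_single,
    show Finsupp.single O (0 - n • (1 : ℤ)) = -(n • Finsupp.single O 1) by simp, smul_sub]
  congr 1
  abel

end Divisible

end FunctionField

/-! ### Local rings of smooth curves -/

section LocalRings

open Polynomial

/-- The local ring of an étale extension `S` of `A[X]`, for a field `A`, at a maximal ideal is a
discrete valuation ring: its maximal ideal is generated by a maximal ideal of `A[X]`. -/
lemma isDiscreteValuationRing_of_etale {A S : Type*} [Field A] [CommRing S] [IsDomain S]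
    [Algebra A[X] S] [Algebra.Etale A[X] S] (q : Ideal S) [q.IsMaximal] :
    IsDiscreteValuationRing (Localization.AtPrime q) := by
  let p := q.under A[X]
  -- by the Nullstellensatz, `p` is not zero
  have hp : p ≠ ⊥ := by
    let : Algebra A S := ((algebraMap A[X] S).comp C).toAlgebra
    have : IsScalarTower A A[X] S := IsScalarTower.of_algebraMap_eq fun _ => rfl
    have : Algebra.FiniteType A S := .trans (S := A[X]) inferInstance inferInstance
    let := Ideal.Quotient.field q
    have : Algebra.FiniteType A (S ⧸ q) := .trans (S := S) inferInstance inferInstance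
    have : Module.Finite A (S ⧸ q) := finite_of_finite_type_of_isJacobsonRing A (S ⧸ q)
    obtain ⟨f, hf, hf'⟩ := Algebra.IsIntegral.isIntegral (R := A)
      (Ideal.Quotient.mk q (algebraMap A[X] S X))
    have hmem : f ∈ p := by
      change algebraMap A[X] S f ∈ q
      rw [← Ideal.Quotient.eq_zero_iff_mem, ← hf']
      have h1 : ((Ideal.Quotient.mk q).comp (algebraMap A[X] S)) =
          eval₂RingHom (algebraMap A (S ⧸ q)) (Ideal.Quotient.mk q (algebraMap A[X] S X)) := by
        refine Polynomial.ringHom_ext (fun a => ?_) (by simp)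
        simp only [RingHom.comp_apply, coe_eval₂RingHom, eval₂_C]
        rfl
      exact congr($h1 f)
    intro h
    rw [h] at hmem
    exact hf.ne_zero (by simpa using hmem)
  have : IsNoetherianRing S := Algebra.FiniteType.isNoetherianRing A[X] S
  let := Localization.AtPrime.algebraOfLiesOver p q
  have hmax := ((Algebra.isUnramifiedAt_iff_map_eq A[X] p q).1 inferInstance).2
  have hinj : Function.Injective (algebraMap A[X] S) := by
    have : Module.Flat A[X] S := inferInstance
    exact FaithfulSMul.algebraMap_injective _ _
  have hq : q ≠ ⊥ := by
    obtain ⟨f, hf, hf0⟩ := Submodule.exists_mem_ne_zero_of_ne_bot hp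
    rintro rfl
    refine hf0 (hinj ?_)
    rw [map_zero]
    simpa [p] using hf
  refine ((IsDiscreteValuationRing.TFAE (Localization.AtPrime q)
    (IsLocalization.AtPrime.not_isField S hq (Localization.AtPrime q))).out 4 0).mp ?_
  rw [← hmax]
  infer_instance

variable {k : Type u} [Field k] {X : Scheme.{u}} [IsIntegral X] (π : X ⟶ Spec (.of k))

/-- The local rings of a smooth curve at its closed points are discrete valuation rings. -/
lemma isDiscreteValuationRing_stalk [SmoothOfRelativeDimension 1 π] (x : X) (hx : IsClosed {x}) :
    IsDiscreteValuationRing (X.presheaf.stalk x) := by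
  obtain ⟨U, hU, V, hV, hxV, e, h⟩ :=
    SmoothOfRelativeDimension.exists_isStandardSmoothOfRelativeDimension (n := 1) (f := π) x
  have hUtop : U = ⊤ := by
    ext y
    have : Subsingleton (Spec (CommRingCat.of k)) :=
      inferInstanceAs (Subsingleton (PrimeSpectrum k))
    simpa [Subsingleton.elim y (π x)] using e hxV
  obtain ⟨g, -, hg⟩ := h.exists_etale_mvPolynomial
  let ε : k ≃+* Γ(Spec (.of k), U) :=
    ((Scheme.ΓSpecIso (.of k)).symm ≪≫
      (Spec (.of k)).presheaf.mapIso (eqToIso hUtop).op).commRingCatIsoToRingEquiv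
  let ε' : k[X] ≃+* MvPolynomial (Fin 1) Γ(Spec (.of k), U) :=
    (Polynomial.mapEquiv ε).trans (MvPolynomial.uniqueAlgEquiv _ (Fin 1)).symm.toRingEquiv
  have hg' := RingHom.Etale.respectsIso.2 g ε' hg
  have : Nonempty V := ⟨⟨x, hxV⟩⟩
  let := (g.comp ε'.toRingHom).toAlgebra
  have : Algebra.Etale k[X] Γ(X, V) := hg'
  have : (hV.primeIdealOf ⟨x, hxV⟩).asIdeal.IsMaximal :=
    hV.primeIdealOf_isMaximal_of_isClosed ⟨x, hxV⟩ hx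
  have := isDiscreteValuationRing_of_etale (A := k) (hV.primeIdealOf ⟨x, hxV⟩).asIdeal
  let := X.presheaf.algebra_section_stalk ⟨x, hxV⟩
  have := hV.isLocalization_stalk ⟨x, hxV⟩
  exact IsDiscreteValuationRing.RingEquivClass.isDiscreteValuationRing
    (IsLocalization.algEquiv (hV.primeIdealOf ⟨x, hxV⟩).asIdeal.primeCompl
      (Localization.AtPrime (hV.primeIdealOf ⟨x, hxV⟩).asIdeal) (X.presheaf.stalk x))

lemma coheight_eq_one [SmoothOfRelativeDimension 1 π] (x : X) (hx : IsClosed {x}) :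
    Order.coheight x = 1 := by
  have := isDiscreteValuationRing_stalk π x hx
  have h := ringKrullDim_stalk_eq_coheight x
  rw [IsDiscreteValuationRing.ringKrullDim_eq_one] at h
  exact_mod_cast h.symm

end LocalRings

/-! ### Smooth curves over an algebraically closed field -/

section Places

variable {k : Type u} [Field k] {X : Scheme.{u}} (π : X ⟶ Spec (.of k))

/-- The global function on `X` with constant value `c`. -/
noncomputable def globalConst (c : k) : Γ(X, ⊤) :=
  π.appTop ((Scheme.ΓSpecIso (.of k)).inv c)

/-- The value of a constant function at a closed point is that constant. -/
lemma residueFieldIsoBase_inv_apply [IsAlgClosed k] [LocallyOfFiniteType π] (x : X)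
    (hx : IsClosed {x}) (c : k) :
    (residueFieldIsoBase π x hx).inv c = X.Γevaluation x (globalConst π c) := by
  have h1 := Scheme.ΓSpecIso_naturality (residueFieldIsoBase π x hx).inv
  rw [SpecMap_residueFieldIsoBase_inv, Scheme.fromSpecResidueField, Scheme.Hom.comp_appTop,
    Scheme.Hom.comp_appTop, Category.assoc, Category.assoc, Scheme.ΓSpecIso_naturality,
    Scheme.fromSpecStalk_appTop] at h1
  have h2 := congr($(h1).hom ((Scheme.ΓSpecIso (.of k)).inv c))
  simp only [homOfLE_refl, op_id, CategoryTheory.Functor.map_id, Category.comp_id,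
    Scheme.ΓSpecIso_inv_naturality, Category.assoc, Scheme.ΓSpecIso_naturality_assoc,
    Iso.inv_hom_id_assoc, CommRingCat.hom_comp, RingHom.coe_comp, Function.comp_apply,
    Iso.inv_hom_id_apply] at h2
  exact h2.symm

variable [IsIntegral X]

instance : Nonempty (⊤ : X.Opens) := ⟨⟨genericPoint X, trivial⟩⟩

lemma constants_eq_germ (c : k) :
    constants π c = X.germToFunctionField ⊤ (globalConst π c) := rfl

lemma ord_constants [IsLocallyNoetherian X] {c : k} (hc : c ≠ 0) (x : X) :
    Scheme.ord (constants π c) x = 0 := by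
  rw [constants_eq_germ]
  have h : IsUnit (((Scheme.ΓSpecIso (.of k)).inv ≫ π.appTop).hom c) := (IsUnit.mk0 c hc).map _
  exact Scheme.ord_of_isUnit (U := ⊤) h trivial

/-- On a noetherian integral scheme all of whose closed points have codimension one, a proper
closed subset contains only finitely many closed points. -/
lemma finite_closedPoints_of_isClosed [IsNoetherian X]
    (hX : ∀ x : X, IsClosed {x} → Order.coheight x = 1) (Z : Set X) (hZ : IsClosed Z)
    (hZX : genericPoint X ∉ Z) : {x : X | IsClosed {x} ∧ x ∈ Z}.Finite := by
  obtain ⟨S, hS, hSc, hSi, rfl⟩ :=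
    TopologicalSpace.NoetherianSpace.exists_finite_set_isClosed_irreducible hZ
  have hsub : {x : X | IsClosed {x} ∧ x ∈ ⋃₀ S} ⊆
      {x : X | {x} ∈ S} := by
    rintro x ⟨hx, t, ht, hxt⟩
    obtain ⟨g, hg⟩ := QuasiSober.sober (hSi t ht) (hSc t ht)
    have hgx : g ⤳ x := hg.specializes hxt
    have hgen : genericPoint X ⤳ g := (genericPoint_spec X).specializes trivial
    have hgX : g ≠ genericPoint X := by
      rintro rfl
      exact hZX ⟨t, ht, hg.mem⟩
    -- otherwise `x < g < η` would be a chain of length two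
    have : g = x := by
      by_contra hne
      have h1 : x < g := ⟨hgx, fun h => hne (hgx.antisymm h).eq⟩
      have h2 : g < genericPoint X := ⟨hgen, fun h => hgX (h.antisymm hgen).eq⟩
      have h3 := Order.coheight_add_one_le h1
      have h4 := Order.coheight_add_one_le h2
      rw [hX x hx] at h3
      have h5 := (add_le_add_left (le_trans le_add_self h4) 1).trans h3
      exact absurd h5 (by norm_num)
    subst this
    have h6 : t = {g} := by
      rw [← hg.def, hx.closure_eq]
    rw [h6] at ht
    exact ht
  refine Set.Finite.subset ?_ hsub
  exact hS.preimage Set.singleton_injective.injOn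

variable [IsLocallyNoetherian X]

/-- A rational function regular at a closed point differs from a constant by a function vanishing
at that point. -/
lemma exists_one_le_ord_sub [IsAlgClosed k] [SmoothOfRelativeDimension 1 π] (x : X)
    (hx : IsClosed {x}) {g : X.functionField} (hg : g ≠ 0) (h : 0 ≤ Scheme.ord g x) :
    ∃ c : k, g - constants π c ≠ 0 → 1 ≤ Scheme.ord (g - constants π c) x := by
  have hsm : Smooth π := SmoothOfRelativeDimension.smooth 1 π
  have := isDiscreteValuationRing_stalk π x hx
  have hx1 := coheight_eq_one π x hx
  have hreg : ∃ a, algebraMap (X.presheaf.stalk x) X.functionField a = g := by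
    refine IsDiscreteValuationRing.exists_lift_of_le_one ?_
    rw [Scheme.le_ord_iff hx1 hg] at h
    change 1 ≤ Ring.ordFrac (X.presheaf.stalk x) g at h
    rw [Ring.ordFrac_eq_valuation_inv] at h
    exact (one_le_inv₀ (by simpa [Valuation.pos_iff] using hg)).1 h
  obtain ⟨a, rfl⟩ := hreg
  obtain ⟨c, hc⟩ : ∃ c, (residueFieldIsoBase π x hx).inv c = X.residue x a :=
    ⟨(residueFieldIsoBase π x hx).hom (X.residue x a), by simp⟩
  refine ⟨c, fun hne => ?_⟩
  have hcg : constants π c = algebraMap (X.presheaf.stalk x) X.functionField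
      (X.presheaf.germ ⊤ x trivial (globalConst π c)) :=
    (Scheme.algebraMap_germ_eq_germToFunctionField X (U := ⊤) (x := x) trivial (globalConst π c)).symm
  rw [hcg, ← map_sub] at hne ⊢
  set b := a - X.presheaf.germ ⊤ x trivial (globalConst π c)
  have hb : ¬ IsUnit b := by
    have h0 : X.residue x b = 0 := by
      rw [map_sub, sub_eq_zero, ← hc, residueFieldIsoBase_inv_apply]
      rfl
    intro hu
    exact (hu.map (X.residue x).hom).ne_zero h0
  have hb0 : b ≠ 0 := by
    rintro h0
    exact hne (by rw [h0, map_zero])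
  have h1 : 0 ≤ Scheme.ord (algebraMap (X.presheaf.stalk x) X.functionField b) x :=
    (Scheme.le_ord_iff hx1 hne).2 (Ring.ordFrac_ge_one_of_ne_zero hb0)
  have h2 : Scheme.ord (algebraMap (X.presheaf.stalk x) X.functionField b) x ≠ 0 := by
    intro h0
    exact hb (Ring.isUnit_iff_ordFrac_one_of_isDiscreteValuationRing.2
      ((Scheme.ord_eq_iff hx1 hne).1 h0))
  omega

lemma finite_ord_ne_zero [SmoothOfRelativeDimension 1 π] [CompactSpace X] {g : X.functionField}
    (hg : g ≠ 0) : {x : closedPoints X | Scheme.ord g x.1 ≠ 0}.Finite := by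
  have : IsNoetherian X := {}
  obtain ⟨U, -, g', hU, rfl, hu⟩ := exists_isUnit_germ_eq X g hg
  have h := finite_closedPoints_of_isClosed (coheight_eq_one π) (U : Set X)ᶜ
    U.isOpen.isClosed_compl (fun h => h
      (((genericPoint_spec X).mem_open_set_iff U.isOpen).2 (by simpa using hU)))
  refine (h.preimage Subtype.val_injective.injOn).subset fun x hx => ⟨x.2, fun hxU => hx ?_⟩
  exact Scheme.ord_of_isUnit hu hxU

/-- The function field of a smooth curve of genus one over an algebraically closed field. -/
noncomputable def functionFieldOfGenusOne [IsAlgClosed k] [SmoothOfRelativeDimension 1 π]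
    [CompactSpace X] (hg : HasGenus π 1) :
    letI := (constants π).toAlgebra
    FunctionField k X.functionField (closedPoints X) :=
  letI := (constants π).toAlgebra
  { ord := fun g x => Scheme.ord g x.1
    ord_mul' := fun hf hg x => Scheme.ord_mul hf hg
    ord_add' := fun _ _ hfg x => by
      have := isDiscreteValuationRing_stalk π x.1 x.2
      exact Scheme.ord_add hfg
    ord_const' := fun hc x => ord_constants π hc x.1
    exists_residue' := fun hf x h => exists_one_le_ord_sub π x.1 x.2 hf h
    finite_support' := fun hf => finite_ord_ne_zero π hf
    riemann_inequality' := fun D => by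
      have h := hg.2 ⟨D, rfl⟩
      dsimp only at h
      have h' : Divisor.degree X D ≤ (ell π D : ℤ) := by push_cast at h; omega
      exact h'
    exists_deg_eq' := by
      obtain ⟨D, h⟩ := hg.1
      dsimp only at h
      have h' : Divisor.degree X D = (ell π D : ℤ) := by push_cast at h; omega
      exact ⟨D, h'⟩ }

/-- `Pic⁰` of a curve of genus one over an algebraically closed field is divisible; moreover every
element is a multiple of the class of a divisor `Q - O`. -/
lemma exists_nsmul_mk_diff [IsAlgClosed k] [SmoothOfRelativeDimension 1 π] [CompactSpace X]
    (hg : HasGenus π 1) {n : ℕ} (hn : 1 ≤ n) (O : closedPoints X) (m : Pic0 X) :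
    ∃ Q, n • Pic0.mk (diff Q O) = m := by
  obtain ⟨⟨D, hD⟩, rfl⟩ := QuotientAddGroup.mk_surjective m
  let := (constants π).toAlgebra
  obtain ⟨Q, g, hg0, h⟩ :=
    (functionFieldOfGenusOne π hg).exists_nsmul_linearEquiv n hn O D hD
  refine ⟨Q, ?_⟩
  rw [← map_nsmul]
  refine QuotientAddGroup.eq.2 (AddSubgroup.mem_addSubgroupOf.2 ⟨g, hg0, fun x => ?_⟩)
  rw [← sub_eq_neg_add]
  exact h x

end Places

/-! ### The geometric points over a closed point -/

section Fibre

variable {K : Type u} [Field K] {C : Scheme.{u}} (f : C ⟶ Spec (.of K))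

/-- The inclusion of the base field in the residue field of a point. -/
noncomputable def baseToResidueField (x : C) : CommRingCat.of K ⟶ C.residueField x :=
  Spec.preimage (C.fromSpecResidueField x ≫ f)

lemma specMap_baseToResidueField (x : C) :
    Spec.map (baseToResidueField f x) = C.fromSpecResidueField x ≫ f :=
  Spec.map_preimage _

lemma finrank_baseToResidueField (x : C) :
    letI := (baseToResidueField f x).hom.toAlgebra
    Module.finrank K (C.residueField x) = f.residueDegree x := by
  let := (baseToResidueField f x).hom.toAlgebra
  let := (f.residueFieldMap x).hom.toAlgebra
  let y : PrimeSpectrum K := f x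
  have hb : Function.Bijective (algebraMap K y.asIdeal.ResidueField) := by
    have hy : y.asIdeal = ⊥ := (Ideal.eq_bot_or_top y.asIdeal).resolve_right y.isPrime.ne_top
    have hm : y.asIdeal.IsMaximal := hy ▸ Ideal.bot_isMaximal
    exact ⟨RingHom.injective _, Ideal.algebraMap_residueField_surjective _⟩
  let i : K ≃+* (Spec (.of K)).residueField (f x) :=
    (RingEquiv.ofBijective _ hb).trans
      (Scheme.Spec.residueFieldIso (.of K) y).symm.commRingCatIsoToRingEquiv
  refine Algebra.finrank_eq_of_equiv_equiv i (RingEquiv.refl _) ?_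
  have h : CommRingCat.ofHom (i : K →+* (Spec (.of K)).residueField (f x)) ≫ f.residueFieldMap x =
      baseToResidueField f x := by
    apply Spec.map_injective
    have hi : CommRingCat.ofHom (i : K →+* (Spec (.of K)).residueField (f x)) =
        CommRingCat.ofHom (algebraMap K y.asIdeal.ResidueField) ≫
          (Scheme.Spec.residueFieldIso (.of K) y).inv := rfl
    rw [specMap_baseToResidueField, hi, Spec.map_comp, Spec.map_comp,
      ← Scheme.Hom.SpecMap_residueFieldMap_fromSpecResidueField,
      ← Scheme.Spec.map_residueFieldIso_inv_eq_fromSpecResidueField]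
  exact congr($(h).hom)

/-- The geometric points over a point `x` correspond to the embeddings over `K` of its residue
field in `K̄`. -/
noncomputable def fibreEquiv [LocallyOfFiniteType f] (x : C) :
    letI := (baseToResidueField f x).hom.toAlgebra
    (C.residueField x →ₐ[K] AlgebraicClosure K) ≃
      {y : closedPoints (geom f) | pullback.fst f (geomPt K) y.1 = x} := by
  letI := (baseToResidueField f x).hom.toAlgebra
  have hφ (φ : C.residueField x →ₐ[K] AlgebraicClosure K) :
      (Spec.map (CommRingCat.ofHom (φ : C.residueField x →+* AlgebraicClosure K)) ≫
        C.fromSpecResidueField x) ≫ f = 𝟙 _ ≫ geomPt K := by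
    rw [Category.assoc, ← specMap_baseToResidueField, ← Spec.map_comp, geomPt, Category.id_comp]
    congr 1
    ext a
    exact φ.commutes a
  let o : Spec (.of (AlgebraicClosure K)) := IsLocalRing.closedPoint (AlgebraicClosure K)
  let p (φ : C.residueField x →ₐ[K] AlgebraicClosure K) :
      {p : Spec (.of (AlgebraicClosure K)) ⟶ geom f // p ≫ geomStr f = 𝟙 _} :=
    ⟨pullback.lift _ _ (hφ φ), pullback.lift_snd _ _ _⟩
  refine Equiv.ofBijective (fun φ => ⟨pointEquivClosedPoint (geomStr f) (p φ), ?_⟩) ⟨?_, ?_⟩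
  · change pullback.fst f (geomPt K) ((p φ).1 o) = x
    rw [← Scheme.Hom.comp_apply, pullback.lift_fst, Scheme.Hom.comp_apply,
      Scheme.fromSpecResidueField_apply]
  · intro φ ψ h
    have h1 := congrArg Subtype.val
      ((pointEquivClosedPoint (geomStr f)).injective (congrArg Subtype.val h))
    have h2 := congr($h1 ≫ pullback.fst f (geomPt K))
    simp only [p, pullback.lift_fst] at h2
    have h3 := (Scheme.SpecToEquivOfField (AlgebraicClosure K) C).symm.injective
      (a₁ := ⟨x, _⟩) (a₂ := ⟨x, _⟩) h2
    have h4 := eq_of_heq (Sigma.mk.inj h3).2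
    ext a
    exact congr($(h4).hom a)
  · rintro ⟨y, hy⟩
    obtain ⟨⟨q, hq⟩, rfl⟩ := (pointEquivClosedPoint (geomStr f)).surjective y
    obtain ⟨⟨x', ψ⟩, hψ⟩ := (Scheme.SpecToEquivOfField (AlgebraicClosure K) C).symm.surjective
      (q ≫ pullback.fst f (geomPt K))
    have hx : x' = x := by
      change pullback.fst f (geomPt K) (q o) = x at hy
      rw [← hy, ← Scheme.Hom.comp_apply, ← hψ, Scheme.SpecToEquivOfField_symm_apply,
        Scheme.Hom.comp_apply, Scheme.fromSpecResidueField_apply]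
    subst hx
    rw [Scheme.SpecToEquivOfField_symm_apply] at hψ
    have hc : baseToResidueField f x' ≫ ψ =
        CommRingCat.ofHom (algebraMap K (AlgebraicClosure K)) := by
      apply Spec.map_injective
      rw [Spec.map_comp, specMap_baseToResidueField, ← Category.assoc, hψ, Category.assoc,
        pullback.condition, ← Category.assoc, hq, Category.id_comp, geomPt]
    let φ : C.residueField x' →ₐ[K] AlgebraicClosure K :=
      { ψ.hom with commutes' := fun a => congr($(hc).hom a) }
    refine ⟨φ, Subtype.ext (congrArg (pointEquivClosedPoint (geomStr f))
      (Subtype.ext (a1 := p φ) (a2 := ⟨q, hq⟩) ?_))⟩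
    apply pullback.hom_ext
    · rw [pullback.lift_fst, ← hψ]
      rfl
    · rw [pullback.lift_snd, hq]

/-- A point of degree `d` over a perfect field gives a divisor of degree `d` on the geometric
fibre, invariant under the Galois group: the sum of the geometric points over it. -/
lemma exists_invariant_divisor [PerfectField K] [LocallyOfFiniteType f] (x : C)
    (hx : f.residueDegree x ≠ 0) :
    ∃ D : Divisor (geom f), Divisor.degree _ D = f.residueDegree x ∧
      ∀ s : Gal(AlgebraicClosure K/K), s • D = D := by
  classical
  let := (baseToResidueField f x).hom.toAlgebra
  have hd := finrank_baseToResidueField f x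
  have : FiniteDimensional K (C.residueField x) :=
    Module.finite_of_finrank_pos (by rw [hd]; omega)
  have : Fintype {y : closedPoints (geom f) | pullback.fst f (geomPt K) y.1 = x} :=
    Fintype.ofEquiv _ (fibreEquiv f x)
  have hcard := Fintype.card_congr (fibreEquiv f x)
  rw [AlgHom.card, hd] at hcard
  refine ⟨∑ y ∈ {y : closedPoints (geom f) | pullback.fst f (geomPt K) y.1 = x}.toFinset,
    Finsupp.single y 1, ?_, fun s => ?_⟩
  · rw [map_sum, hcard]
    simp [Divisor.degree]
  · ext y
    rw [smul_divisor_apply]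
    have h : pullback.fst f (geomPt K) (s⁻¹ • y).1 = pullback.fst f (geomPt K) y.1 := by
      rw [smul_closedPoint_val, ← Scheme.Hom.comp_apply, galAut_fst]
    simp [Finsupp.finsetSum_apply, Finsupp.single_apply, h]

end Fibre

/-! ### Lifting cocycles to the torsion -/

section Lift

variable {G M : Type*} [Group G] [TopologicalSpace G] [AddCommGroup M] [DistribMulAction G M]

/-- If `d • c` is the coboundary of `d • n` then `c` is cohomologous, via `n`, to a cocycle with
values in the `d`-torsion; this is a continuous cocycle as soon as the coboundary of `n` is. -/
lemma exists_map_torsionIncl_eq (d : ℕ) (c : Z1 G M) (n : M)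
    (hn : IsLocallyConstant fun s : G => s • n) (h : ∀ s, d • c.1 s = s • (d • n) - d • n) :
    ∃ ξ : H1 G (AddSubgroup.torsionBy M (d : ℤ)),
      H1.map (torsionIncl G M d) ξ = QuotientAddGroup.mk c := by
  have htors (s : G) : c.1 s - (s • n - n) ∈ AddSubgroup.torsionBy M (d : ℤ) := by
    rw [AddSubgroup.torsionBy.nsmul_iff, smul_sub, smul_sub, h, smul_comm d s n, sub_self]
  let c' : Z1 G (AddSubgroup.torsionBy M (d : ℤ)) :=
    ⟨fun s => ⟨c.1 s - (s • n - n), htors s⟩,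
      (c.2.1.sub (hn.sub (.const n))).desc _ Subtype.val Subtype.val_injective,
      fun s t => Subtype.ext (by
        change c.1 (s * t) - ((s * t) • n - n) = c.1 s - (s • n - n) + s • (c.1 t - (t • n - n))
        rw [c.2.2, mul_smul, smul_sub, smul_sub]
        abel)⟩
  refine ⟨QuotientAddGroup.mk c', ?_⟩
  refine QuotientAddGroup.eq.2 (AddSubgroup.mem_addSubgroupOf.2 ⟨n, fun s => ?_⟩)
  change -(c.1 s - (s • n - n)) + c.1 s = s • n - n
  abel

end Lift

end GenusOne

/-! ### The Weil-Châtelet class -/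

theorem mainTheorem4 {K : Type u} [Field K] [PerfectField K] {C : Scheme.{u}}
    (f : C ⟶ Spec (.of K)) [SmoothOfRelativeDimension 1 f] [IsProper f]
    [GeometricallyIntegral f] (hgenus : GenusOne.HasGenus (GenusOne.geomStr f) 1)
    (d : ℕ) (hd : 2 ≤ d)
    (hpoint : ∃ x : C, IsClosed {x} ∧ f.residueDegree x = d) :
    d • GenusOne.wcClass f = 0 ∧
      ∃ ξ : GenusOne.H1 Gal(AlgebraicClosure K/K)
          (AddSubgroup.torsionBy (GenusOne.Jac f) (d : ℤ)),
        GenusOne.H1.map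
          (GenusOne.torsionIncl Gal(AlgebraicClosure K/K) (GenusOne.Jac f) d) ξ =
            GenusOne.wcClass f := by
  open GenusOne in
  obtain ⟨x, -, hx⟩ := hpoint
  obtain ⟨D, hD, hinv⟩ := exists_invariant_divisor f x (by omega)
  rw [hx] at hD
  obtain ⟨P⟩ : Nonempty (closedPoints (geom f)) := inferInstance
  rw [wcClass_eq f P]
  -- the class of `d P - D` has coboundary `d` times the cocycle
  let m : Jac f := Pic0.mk ⟨d • Finsupp.single P 1 - D, by
    rw [AddMonoidHom.mem_ker, map_sub, map_nsmul, hD]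
    simp [Divisor.degree]⟩
  have hm (s : Gal(AlgebraicClosure K/K)) : d • (wcCocycle f P).1 s = s • m - m := by
    change d • Pic0.mk (diff (s • P) P) = _
    rw [smul_mk, ← map_nsmul, ← map_sub]
    refine congrArg Pic0.mk (Subtype.ext ?_)
    change d • (Finsupp.single (s • P) 1 - Finsupp.single P 1 : Divisor (geom f)) =
      s • (d • Finsupp.single P 1 - D) - (d • Finsupp.single P 1 - D)
    rw [smul_sub s, hinv, smul_comm s d, smul_divisor_def, Finsupp.mapDomain_single, smul_sub]
    abel
  refine ⟨(QuotientAddGroup.eq_zero_iff _).2 (AddSubgroup.mem_addSubgroupOf.2 ⟨m, hm⟩), ?_⟩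
  have : SmoothOfRelativeDimension 1 (geomStr f) :=
    (smoothOfRelativeDimension_isStableUnderBaseChange 1).of_isPullback
      (IsPullback.of_hasPullback f (geomPt K)) inferInstance
  have : CompactSpace (geom f) := QuasiCompact.compactSpace_of_compactSpace (geomStr f)
  obtain ⟨Q, hQ⟩ := exists_nsmul_mk_diff (geomStr f) hgenus (n := d) (by omega) P m
  refine exists_map_torsionIncl_eq d _ (Pic0.mk (diff Q P)) ?_ (by rw [hQ]; exact hm)
  -- `s • [Q - P]` depends only on `s • Q` and `s • P`
  have h := (isLocallyConstant_smul f Q).prodMk (isLocallyConstant_smul f P)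
  convert h.comp fun q => Pic0.mk (diff q.1 q.2) using 2 with s
  rw [smul_mk]
  refine congrArg Pic0.mk (Subtype.ext ?_)
  change s • (diff Q P).1 = _
  simp [diff, smul_sub]
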